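/- Let $d\ge 1$ and $s\in[0,1]$, and let $\mathbb{T}^d=(\mathbb{R}/\mathbb{Z})^d$ with Lebesgue measure and Fourier coefficients $\hat u(\xi)=\int_{\mathbb{T}^d}u(x)e^{-2\pi i x\cdot\xi}\,dx$, $\xi\in\mathbb{Z}^d$. Let $H^s_{av}$ be the Hilbert space of real functions $u\in L^2(\mathbb{T}^d)$ with $\int u\,dx=0$ and $\sum_\xi(1+|\xi|^{2s})|\hat u(\xi)|^2<\infty$, with the inner product $(u,v)_{H^s_{av}}=\sum_\xi|\xi|^{2s}\hat u(\xi)\overline{\hat v(\xi)}$, and let $H^{-s}_{av}$ be its dual space. The operator $(-\Delta_{av})^s:H^s_{av}\to H^{-s}_{av}$ is the Fourier multiplier with symbol $|\xi|^{2s}$, that is, $\langle(-\Delta_{av})^su,v\rangle=(u,v)_{H^s_{av}}$; it is an isometric isomorphism, and $(f,g)_{H^{-s}_{av}}=\langle(-\Delta_{av})^{-s}f,g\rangle$ for $f,g\in H^{-s}_{av}$, where $(-\Delta_{av})^{-s}$ is its inverse. The total variation of $u\in L^1(\mathbb{T}^d)$ is $\int|Du|=\sup\{\int u\operatorname{div}z\,dx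 : z\in C^1(\mathbb{T}^d;\mathbb{R}^d),\ |z|\le 1\}$, where $|\cdot|$ is the Euclidean norm, and $BV(\mathbb{T}^d)$ is the set of those $u\in L^1(\mathbb{T}^d)$ for which it is finite. For $u\in H^{-s}_{av}$ let $\Phi(u)=\int|Du|$ if $u\in BV(\mathbb{T}^d)$, that is, if $u$ is given by a mean-zero function in $BV(\mathbb{T}^d)$, and $\Phi(u)=+\infty$ otherwise. Let $$\tilde\Phi(v)=\sup\Big\{\frac{(w,v)_{H^{-s}_{av}}}{\Phi(w)} : w\in H^{-s}_{av}\setminus\{0\}\Big\},\qquad \partial\Phi(u)=\{v\in H^{-s}_{av} : \Phi(w)\ge\Phi(u)+(v,w-u)_{H^{-s}_{av}}\ \text{for all } w\in H^{-s}_{av}\}.$$ Let $X$ be the set of the $z\in L^\infty(\mathbb{T}^d;\mathbb{R}^d)$ whose distributional divergence lies in $H^s_{av}$, let $\|z\|_\infty$ be the essential supremum of $|z|$, and let $$\Psi(w)=\inf\{\|z\|_\infty : z\in X,\ w=-(-\Delta_{av})^s\operatorname{div}z\},\qquad \inf\emptyset=+\infty.$$ (i) $\tilde\Phi(w)=\Psi(w)$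 for every $w\in H^{-s}_{av}$. (ii) Let $u\in H^{-s}_{av}$ with $\Phi(u)<\infty$ and let $v\in H^{-s}_{av}$. Then $v\in\partial\Phi(u)$ if and only if there is $z\in X$ with $$v=-(-\Delta_{av})^s\operatorname{div}z,\qquad \|z\|_\infty\le 1,\qquad (u,v)_{H^{-s}_{av}}=\int|Du|.$$ -/

import Mathlib

open MeasureTheory
open scoped ENNReal NNReal

noncomputable section

namespace TorusTV

/-- The flat torus `(ℝ/ℤ)^d`. -/
abbrev Torus (d : ℕ) : Type := UnitAddTorus (Fin d)

/-- Lebesgue measure on the torus, of total mass one. -/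
abbrev torusMeasure (d : ℕ) : Measure (Torus d) :=
  Measure.pi fun _ => (AddCircle.haarAddCircle : Measure UnitAddCircle)

/-! ### Fourier coefficients of real square integrable functions -/

/-- The Euclidean length `|ξ|` of a frequency `ξ ∈ ℤ^d`. -/
def freqNorm {d : ℕ} (ξ : Fin d → ℤ) : ℝ :=
  ‖(WithLp.toLp 2 (fun i => (ξ i : ℝ)) : EuclideanSpace ℝ (Fin d))‖

/-- The Fourier coefficient `∫ u(x) exp(-2πi x·ξ) dx` of a real function. -/
def coeff {d : ℕ} (u : Lp ℝ 2 (torusMeasure d)) (ξ : Fin d → ℤ) : ℂ :=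
  UnitAddTorus.mFourierCoeff (fun x => ((u x : ℝ) : ℂ)) ξ

/-- A real `L²` function seen as a complex one. -/
def complexify (d : ℕ) : Lp ℝ 2 (torusMeasure d) →L[ℝ] Lp ℂ 2 (torusMeasure d) :=
  Complex.ofRealCLM.compLpL 2 (torusMeasure d)

/-- The complete system of exponentials, as a Hilbert basis of `L²`. -/
def expBasis (d : ℕ) : HilbertBasis (Fin d → ℤ) ℂ (Lp ℂ 2 (torusMeasure d)) :=
  UnitAddTorus.mFourierBasis (d := Fin d)

theorem coeff_eq_repr {d : ℕ} (u : Lp ℝ 2 (torusMeasure d)) (ξ : Fin d → ℤ) :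
    coeff u ξ = (expBasis d).repr (complexify d u) ξ := by
  have h := UnitAddTorus.mFourierBasis_repr (d := Fin d) (complexify d u) ξ
  refine Eq.trans ?_ h.symm
  unfold coeff UnitAddTorus.mFourierCoeff
  apply integral_congr_ae
  filter_upwards [Complex.ofRealCLM.coeFn_compLpL (p := 2) (μ := torusMeasure d) u] with x hx
  have hx' : (complexify d u) x = ((u x : ℝ) : ℂ) := hx
  rw [hx']

theorem coeff_zero_freq {d : ℕ} (u : Lp ℝ 2 (torusMeasure d)) :
    coeff u 0 = ((∫ x, u x ∂(torusMeasure d) : ℝ) : ℂ) := by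
  rw [← integral_complex_ofReal]
  unfold coeff UnitAddTorus.mFourierCoeff
  simp [UnitAddTorus.mFourier_zero]
  rfl

theorem coeff_add {d : ℕ} (u v : Lp ℝ 2 (torusMeasure d)) (ξ : Fin d → ℤ) :
    coeff (u + v) ξ = coeff u ξ + coeff v ξ := by
  simp [coeff_eq_repr]

theorem coeff_smul {d : ℕ} (c : ℝ) (u : Lp ℝ 2 (torusMeasure d)) (ξ : Fin d → ℤ) :
    coeff (c • u) ξ = (c : ℂ) * coeff u ξ := by
  have : complexify d (c • u) = (c : ℂ) • complexify d u := by
    rw [map_smul]; rfl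
  rw [coeff_eq_repr, coeff_eq_repr, this, map_smul]
  rfl

theorem complexify_norm {d : ℕ} (u : Lp ℝ 2 (torusMeasure d)) : ‖complexify d u‖ = ‖u‖ := by
  rw [Lp.norm_def, Lp.norm_def]
  congr 1
  apply eLpNorm_congr_norm_ae
  filter_upwards [Complex.ofRealCLM.coeFn_compLpL (p := 2) (μ := torusMeasure d) u] with x hx
  have hx' : (complexify d u) x = ((u x : ℝ) : ℂ) := hx
  rw [hx']; simp

theorem freqNorm_nonneg {d : ℕ} (ξ : Fin d → ℤ) : 0 ≤ freqNorm ξ := norm_nonneg _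

theorem one_le_freqNorm {d : ℕ} {ξ : Fin d → ℤ} (h : ξ ≠ 0) : 1 ≤ freqNorm ξ := by
  obtain ⟨i, hi⟩ := Function.ne_iff.mp h
  have h1 : (1 : ℝ) ≤ |(ξ i : ℝ)| := by exact_mod_cast Int.one_le_abs hi
  have h2 := PiLp.norm_apply_le
    (WithLp.toLp 2 (fun i => (ξ i : ℝ)) : EuclideanSpace ℝ (Fin d)) i
  refine h1.trans (le_trans (le_of_eq ?_) h2)
  simp


/-! ### The Sobolev space of mean-zero functions -/

theorem sobolevWeight_bound {d : ℕ} (s : ℝ≥0) (ξ : Fin d → ℤ) :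
    freqNorm ξ ^ (2 * (s : ℝ)) = (freqNorm ξ ^ (s : ℝ)) ^ 2 := by
  rw [mul_comm, Real.rpow_mul (freqNorm_nonneg ξ)]
  norm_num

theorem coeff_sq_summable {d : ℕ} (u : Lp ℝ 2 (torusMeasure d)) :
    Summable fun ξ => ‖coeff u ξ‖ ^ 2 := by
  have h := (lp.memℓp ((expBasis d).repr (complexify d u))).summable (by norm_num)
  simpa [coeff_eq_repr] using h

theorem summable_energy_iff {d : ℕ} (s : ℝ≥0) (u : Lp ℝ 2 (torusMeasure d)) :
    (Summable fun ξ => (1 + freqNorm ξ ^ (2 * (s : ℝ))) * ‖coeff u ξ‖ ^ 2) ↔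
      Memℓp (fun ξ => ((freqNorm ξ ^ (s : ℝ) : ℝ) : ℂ) * coeff u ξ) 2 := by
  rw [memℓp_gen_iff (by norm_num)]
  have key : ∀ ξ : Fin d → ℤ, ‖((freqNorm ξ ^ (s : ℝ) : ℝ) : ℂ) * coeff u ξ‖ ^ (2 : ℝ≥0∞).toReal
      = freqNorm ξ ^ (2 * (s : ℝ)) * ‖coeff u ξ‖ ^ 2 := by
    intro ξ
    rw [sobolevWeight_bound, norm_mul, Complex.norm_real, Real.norm_of_nonneg
      (Real.rpow_nonneg (freqNorm_nonneg ξ) _)]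
    norm_num [mul_pow]
  simp_rw [key, add_mul, one_mul]
  constructor
  · intro h
    simpa using h.sub (coeff_sq_summable u)
  · intro h
    exact (coeff_sq_summable u).add h

/-- The real functions in `H^s` of the torus with mean zero: those `u ∈ L²` with zero integral for
which `∑ (1 + |ξ|^(2s)) |û(ξ)|²` is finite. -/
def sobolevSubmodule (d : ℕ) (s : ℝ≥0) : Submodule ℝ (Lp ℝ 2 (torusMeasure d)) where
  carrier := {u | ∫ x, u x ∂(torusMeasure d) = 0 ∧
    Summable fun ξ => (1 + freqNorm ξ ^ (2 * (s : ℝ))) * ‖coeff u ξ‖ ^ 2}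
  zero_mem' := by
    have h0 : ∀ ξ, coeff (0 : Lp ℝ 2 (torusMeasure d)) ξ = 0 := by
      intro ξ; simp [coeff_eq_repr]
    refine ⟨?_, ?_⟩
    · have := coeff_zero_freq (0 : Lp ℝ 2 (torusMeasure d))
      rw [h0] at this
      exact_mod_cast this.symm
    · simp [h0]
  add_mem' := by
    rintro u v ⟨hu0, hu⟩ ⟨hv0, hv⟩
    refine ⟨?_, ?_⟩
    · have h1 := coeff_zero_freq u
      have h2 := coeff_zero_freq v
      have h3 := coeff_zero_freq (u + v)
      rw [coeff_add, h1, h2, hu0, hv0] at h3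
      simpa using (Complex.ofReal_injective (by simpa using h3)).symm
    · rw [summable_energy_iff] at hu hv ⊢
      convert hu.add hv using 1
      ext ξ
      simp [coeff_add, mul_add]
  smul_mem' := by
    rintro c u ⟨hu0, hu⟩
    refine ⟨?_, ?_⟩
    · have h1 := coeff_zero_freq u
      have h3 := coeff_zero_freq (c • u)
      rw [coeff_smul, h1, hu0] at h3
      simpa using (Complex.ofReal_injective (by simpa using h3)).symm
    · rw [summable_energy_iff] at hu ⊢
      convert hu.const_smul (c : ℂ) using 1
      ext ξ
      simp [coeff_smul, mul_left_comm]

/-- The space `H^s_av` of real functions with mean zero on the torus. It is a copy of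
`sobolevSubmodule d s`, so that it can carry its own norm instead of the one of `L²`. -/
def HsAv (d : ℕ) (s : ℝ≥0) : Type := sobolevSubmodule d s

namespace HsAv

variable {d : ℕ} {s : ℝ≥0}

instance : AddCommGroup (HsAv d s) := inferInstanceAs (AddCommGroup (sobolevSubmodule d s))

instance : Module ℝ (HsAv d s) := inferInstanceAs (Module ℝ (sobolevSubmodule d s))

/-- The inclusion of `H^s_av` in `L²`. -/
def toL2 : HsAv d s →ₗ[ℝ] Lp ℝ 2 (torusMeasure d) := (sobolevSubmodule d s).subtype

theorem toL2_mem (u : HsAv d s) : toL2 u ∈ sobolevSubmodule d s := Subtype.property u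

theorem toL2_injective : Function.Injective (toL2 : HsAv d s → Lp ℝ 2 (torusMeasure d)) :=
  Subtype.val_injective

theorem coeff_zero (u : HsAv d s) : coeff (toL2 u) 0 = 0 := by
  rw [coeff_zero_freq, (toL2_mem u).1]; simp

/-- The sequence `|ξ|^s û(ξ)`, an element of `ℓ²(ℤ^d)`. -/
def weighted : HsAv d s →ₗ[ℝ] lp (fun _ : Fin d → ℤ => ℂ) 2 where
  toFun u := ⟨fun ξ => ((freqNorm ξ ^ (s : ℝ) : ℝ) : ℂ) * coeff (toL2 u) ξ,
    (summable_energy_iff s _).1 (toL2_mem u).2⟩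
  map_add' u v := by
    ext ξ
    simp only [map_add, coeff_add, mul_add]
    rfl
  map_smul' c u := by
    ext ξ
    simp [coeff_smul, mul_left_comm]

theorem weighted_apply (u : HsAv d s) (ξ : Fin d → ℤ) :
    weighted u ξ = ((freqNorm ξ ^ (s : ℝ) : ℝ) : ℂ) * coeff (toL2 u) ξ := rfl

theorem norm_coeff_le (u : HsAv d s) (ξ : Fin d → ℤ) :
    ‖coeff (toL2 u) ξ‖ ≤ ‖weighted u ξ‖ := by
  by_cases h : ξ = 0
  · subst h; rw [coeff_zero]; simp
  · rw [weighted_apply, norm_mul, Complex.norm_real]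
    have h1 : 1 ≤ freqNorm ξ ^ (s : ℝ) := Real.one_le_rpow (one_le_freqNorm h) s.2
    have h2 : 1 ≤ ‖freqNorm ξ ^ (s : ℝ)‖ := h1.trans (le_abs_self _)
    nlinarith [norm_nonneg (coeff (toL2 u) ξ)]

theorem norm_toL2_le (u : HsAv d s) : ‖toL2 u‖ ≤ ‖weighted u‖ := by
  rw [← complexify_norm, ← (expBasis d).repr.norm_map]
  refine lp.norm_mono (p := 2) (by norm_num) fun ξ => ?_
  rw [← coeff_eq_repr]
  exact norm_coeff_le u ξ

theorem weighted_injective :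
    Function.Injective (weighted : HsAv d s → lp (fun _ : Fin d → ℤ => ℂ) 2) := by
  rw [injective_iff_map_eq_zero]
  intro u hu
  apply toL2_injective
  have := norm_toL2_le u
  rw [hu, norm_zero] at this
  rw [map_zero]
  exact norm_le_zero_iff.1 this

instance : NormedAddCommGroup (HsAv d s) :=
  NormedAddCommGroup.induced _ _ (weighted (d := d) (s := s)) weighted_injective

instance : InnerProductSpace ℝ (HsAv d s) :=
  InnerProductSpace.induced (weighted (d := d) (s := s))

/-- The inner product of `H^s_av` is `∑ |ξ|^(2s) û(ξ) v̂(ξ)`, the second factor conjugated as usual;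
for real functions the sum is real. -/
theorem inner_eq_tsum (u v : HsAv d s) :
    inner ℝ u v = ∑' ξ, freqNorm ξ ^ (2 * (s : ℝ)) *
      (coeff (toL2 u) ξ * (starRingEnd ℂ) (coeff (toL2 v) ξ)).re := by
  change inner ℝ (weighted u) (weighted v) = _
  rw [lp.inner_eq_tsum]
  refine tsum_congr fun ξ => ?_
  rw [weighted_apply, weighted_apply, sobolevWeight_bound, Complex.inner]
  simp
  ring

theorem norm_eq_weighted (u : HsAv d s) : ‖u‖ = ‖weighted u‖ := rfl

instance : CompleteSpace (HsAv d s) := by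
  apply Metric.complete_of_cauchySeq_tendsto
  intro u hu
  let W : HsAv d s →L[ℝ] lp (fun _ : Fin d → ℤ => ℂ) 2 :=
    weighted.mkContinuous 1 (fun v => by rw [one_mul, norm_eq_weighted])
  let J : HsAv d s →L[ℝ] Lp ℝ 2 (torusMeasure d) :=
    toL2.mkContinuous 1 (fun v => by rw [one_mul, norm_eq_weighted]; exact norm_toL2_le v)
  obtain ⟨c, hc⟩ := cauchySeq_tendsto_of_complete (W.uniformContinuous.comp_cauchySeq hu)
  obtain ⟨w, hw⟩ := cauchySeq_tendsto_of_complete (J.uniformContinuous.comp_cauchySeq hu)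
  have hcoef : ∀ ξ, Filter.Tendsto (fun n => coeff (toL2 (u n)) ξ) Filter.atTop
      (nhds (coeff w ξ)) := by
    intro ξ
    have hcont : Continuous fun v : Lp ℝ 2 (torusMeasure d) => coeff v ξ := by
      have h1 : (fun v : Lp ℝ 2 (torusMeasure d) => coeff v ξ) =
          fun v => inner ℂ (expBasis d ξ) (complexify d v) := by
        funext v
        rw [coeff_eq_repr, HilbertBasis.repr_apply_apply]
      rw [h1]
      exact continuous_const.inner (complexify d).continuous
    exact (hcont.tendsto w).comp hw
  have hweight : ∀ ξ, Filter.Tendsto (fun n => weighted (u n) ξ) Filter.atTop (nhds (c ξ)) := by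
    intro ξ
    rw [tendsto_iff_norm_sub_tendsto_zero] at hc ⊢
    refine squeeze_zero (fun _ => norm_nonneg _) (fun n => ?_) hc
    exact lp.norm_apply_le_norm (by norm_num) (weighted (u n) - c) ξ
  have hcw : ∀ ξ, c ξ = ((freqNorm ξ ^ (s : ℝ) : ℝ) : ℂ) * coeff w ξ := fun ξ =>
    tendsto_nhds_unique (hweight ξ) ((hcoef ξ).const_mul _)
  have hw0 : coeff w 0 = 0 := by
    refine tendsto_nhds_unique (hcoef 0) ?_
    simp [coeff_zero]
  have hmem : w ∈ sobolevSubmodule d s := by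
    refine ⟨?_, ?_⟩
    · rw [coeff_zero_freq] at hw0
      exact_mod_cast hw0
    · rw [summable_energy_iff]
      have := lp.memℓp c
      convert this using 1
      ext ξ
      exact (hcw ξ).symm
  let v : HsAv d s := ⟨w, hmem⟩
  refine ⟨v, ?_⟩
  rw [tendsto_iff_norm_sub_tendsto_zero] at hc ⊢
  refine hc.congr fun n => ?_
  rw [norm_eq_weighted, map_sub]
  congr 2
  ext ξ
  rw [hcw, weighted_apply]
  rfl

end HsAv

/-! ### The dual space and the fractional Laplacian -/

/-- The space `H^{-s}_av`, the dual of `H^s_av`. -/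
abbrev HNegAv (d : ℕ) (s : ℝ≥0) : Type := StrongDual ℝ (HsAv d s)

/-- The operator `(-Δ_av)^s : H^s_av → H^{-s}_av`, the Fourier multiplier with symbol `|ξ|^(2s)`:
by `fracLaplacian_apply`, `⟨(-Δ_av)^s u, v⟩` is the sum over `ξ` of `|ξ|^(2s) û(ξ)` times the
conjugate of `v̂(ξ)`. It is bijective and isometric by the Riesz representation theorem. -/
def fracLaplacian (d : ℕ) (s : ℝ≥0) : HsAv d s ≃ₗᵢ[ℝ] HNegAv d s :=
  InnerProductSpace.toDual ℝ (HsAv d s)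

theorem fracLaplacian_apply {d : ℕ} {s : ℝ≥0} (u v : HsAv d s) :
    fracLaplacian d s u v = ∑' ξ, freqNorm ξ ^ (2 * (s : ℝ)) *
      (coeff (HsAv.toL2 u) ξ * (starRingEnd ℂ) (coeff (HsAv.toL2 v) ξ)).re :=
  HsAv.inner_eq_tsum u v

/-- The inner product `(f, g) = ⟨(-Δ_av)^{-s} f, g⟩` of `H^{-s}_av`. -/
def innerNeg {d : ℕ} {s : ℝ≥0} (f g : HNegAv d s) : ℝ := g ((fracLaplacian d s).symm f)

/-! ### Calculus on the torus -/

/-- The function `f` on the torus, seen as a periodic function on `ℝ^d`, is of class `C^n`. -/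
def IsCn {d : ℕ} {E : Type*} [NormedAddCommGroup E] [NormedSpace ℝ E] (n : ℕ∞)
    (f : Torus d → E) : Prop :=
  ContDiff ℝ n fun y : Fin d → ℝ => f fun i => (y i : UnitAddCircle)

/-- The partial derivative of `f` in the `i`-th coordinate direction. -/
def partialDeriv {d : ℕ} (i : Fin d) (f : Torus d → ℝ) (x : Torus d) : ℝ :=
  deriv (fun t : ℝ => f (x + Pi.single i (t : UnitAddCircle))) 0

/-- The gradient of a function on the torus. -/
def grad {d : ℕ} (f : Torus d → ℝ) (x : Torus d) : EuclideanSpace ℝ (Fin d) :=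
  WithLp.toLp 2 fun i => partialDeriv i f x

/-- The divergence of a vector field on the torus. -/
def divergence {d : ℕ} (z : Torus d → EuclideanSpace ℝ (Fin d)) (x : Torus d) : ℝ :=
  ∑ i, partialDeriv i (fun y => z y i) x

/-- The total variation `∫ |Du|` of an integrable function `u` on the torus: the supremum of
`∫ u div z` over the `C^1` vector fields `z` with `|z| ≤ 1` everywhere. -/
def totalVariation {d : ℕ} (u : Torus d → ℝ) : ℝ≥0∞ :=
  ⨆ (z : Torus d → EuclideanSpace ℝ (Fin d)) (_ : IsCn 1 z) (_ : ∀ x, ‖z x‖ ≤ 1),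
    ENNReal.ofReal (∫ x, u x * divergence z x ∂(torusMeasure d))

/-- The element `u` of `H^{-s}_av` is the (integrable, mean-zero) function `g`, that is,
`⟨u, ψ⟩ = ∫ g ψ` for the smooth functions `ψ` with mean zero. -/
def IsFunction {d : ℕ} {s : ℝ≥0} (u : HNegAv d s) (g : Torus d → ℝ) : Prop :=
  Integrable g (torusMeasure d) ∧ ∫ x, g x ∂(torusMeasure d) = 0 ∧
    ∀ (φ : HsAv d s) (ψ : Torus d → ℝ), IsCn ⊤ ψ → HsAv.toL2 φ =ᵐ[torusMeasure d] ψ →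
      u φ = ∫ x, g x * ψ x ∂(torusMeasure d)

/-- The functional `Φ` on `H^{-s}_av`: the total variation on `BV ∩ H^{-s}_av`, and `+∞` elsewhere.
The function `g` that represents `u` is unique almost everywhere, and the total variation does not
depend on its values on a null set; so the infimum is the total variation of `g` if there is such
a `g`, and `+∞` if there is none. -/
def Phi {d : ℕ} {s : ℝ≥0} (u : HNegAv d s) : ℝ≥0∞ :=
  ⨅ (g : Torus d → ℝ) (_ : IsFunction u g), totalVariation g

/-- The dual functional of `F` on `H^{-s}_av`, the supremum of `(w, v) / F w` over `w ≠ 0`. -/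
def dualFunctional {d : ℕ} {s : ℝ≥0} (F : HNegAv d s → ℝ≥0∞) (v : HNegAv d s) : EReal :=
  ⨆ (w : HNegAv d s) (_ : w ≠ 0), ((innerNeg w v : ℝ) : EReal) / ((F w : ℝ≥0∞) : EReal)

/-- The subdifferential of `F` at `u` in the Hilbert space `H^{-s}_av`. -/
def subdifferential {d : ℕ} {s : ℝ≥0} (F : HNegAv d s → ℝ≥0∞) (u : HNegAv d s) :
    Set (HNegAv d s) :=
  {v | ∀ w, ((F u : ℝ≥0∞) : EReal) + ((innerNeg v (w - u) : ℝ) : EReal) ≤ ((F w : ℝ≥0∞) : EReal)}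

/-- Bounded measurable vector fields, with the essential supremum of the Euclidean length as
norm. -/
abbrev BoundedField (d : ℕ) : Type := Lp (EuclideanSpace ℝ (Fin d)) ∞ (torusMeasure d)

/-- The distributional divergence of `z` is the function `p`. -/
def HasDiv {d : ℕ} (z : BoundedField d) (p : Lp ℝ 2 (torusMeasure d)) : Prop :=
  ∀ ψ : Torus d → ℝ, IsCn ⊤ ψ →
    ∫ x, inner ℝ (z x) (grad ψ x) ∂(torusMeasure d) = -∫ x, p x * ψ x ∂(torusMeasure d)

/-- `z ∈ L^∞`, its distributional divergence is in `H^s_av`, and `w = -(-Δ_av)^s div z`. -/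
def IsFluxOf {d : ℕ} {s : ℝ≥0} (z : BoundedField d) (w : HNegAv d s) : Prop :=
  ∃ p : HsAv d s, HasDiv z (HsAv.toL2 p) ∧ w = -fracLaplacian d s p

/-- The functional `Ψ(w) = inf {‖z‖_∞ : div z ∈ H^s_av, w = -(-Δ_av)^s div z}`, which is `+∞` if
there is no such `z`. -/
def Psi {d : ℕ} {s : ℝ≥0} (w : HNegAv d s) : ℝ≥0∞ :=
  ⨅ (z : BoundedField d) (_ : IsFluxOf z w), ‖z‖ₑ

end TorusTV

end

/-! Both parts rest on one duality. If `v = -(-Δ)^s p` with `p = div z`, then `(w, v)` in `H^{-s}`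
equals `-w(p)`; when `w` is a function `g` this is formally `-∫ g div z`, which is at most `‖z‖_∞
∫|Dg|`.

To make this rigorous (`ofReal_innerNeg_le`), `z` is mollified with an even weight of mass one. The
mollified field is smooth and still bounded by `‖z‖_∞`, so it is admissible in the total variation
up to scaling. Its divergence has the coefficients of `p` multiplied by real factors that are at
most one in absolute value and tend to one. Hence the divergences converge weakly to `p` in `H^s`,
which is enough to pass to the limit in `w`. This gives `(w, v) ≤ ‖z‖_∞ Φ(w)`.

Conversely (`exists_isFluxOf_of_le_Phi`), suppose `(w, v) ≤ M Φ(w)` for all `w`. With `p = (-Δ)^{-s}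
v`, testing on smooth functions gives `∫ p ψ ≤ M ∫|∇ψ|`. So `∇ψ ↦ ∫ p ψ` is well defined on
gradients and dominated by `M` times the `L¹` norm. Hahn-Banach extends it to all `L²` fields under
the same bound, Riesz represents it by a field `z`, and the `L¹` bound forces `|z| ≤ M` almost
everywhere. Then `div z = -p`, so `z` is a flux of `v`.

Part (i) is these two inequalities with `M` the supremum of the quotients. For (ii), the
one-homogeneity of `Φ` turns `v ∈ ∂Φ(u)` into `(u, v) = Φ(u)` together with `(w, v) ≤ Φ(w)` for all
`w`, which is the case `M = 1`. -/

noncomputable section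

namespace TorusTV

variable {d : ℕ}

/-! ### Calculus on the torus through the covering map -/

/-- The covering map `ℝ^d → (ℝ/ℤ)^d`. -/
def proj (y : Fin d → ℝ) : Torus d := fun i => (y i : UnitAddCircle)

theorem proj_add (y y' : Fin d → ℝ) : proj (y + y') = proj y + proj y' := by
  ext i; simp [proj]

theorem proj_sub (y y' : Fin d → ℝ) : proj (y - y') = proj y - proj y' := by
  ext i; simp [proj]

theorem proj_neg (y : Fin d → ℝ) : proj (-y) = -proj y := by
  ext i; simp [proj]

theorem proj_zero : proj (0 : Fin d → ℝ) = 0 := by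
  ext i; simp [proj]

theorem proj_single (i : Fin d) (t : ℝ) :
    proj (Pi.single i t) = Pi.single i (t : UnitAddCircle) := by
  ext j
  by_cases h : j = i
  · subst h; simp [proj]
  · simp [proj, h]

theorem proj_surjective : Function.Surjective (proj : (Fin d → ℝ) → Torus d) := by
  intro x
  choose y hy using fun i => QuotientAddGroup.mk_surjective (x i)
  exact ⟨y, funext hy⟩

/-- Continuity on the torus can thus be tested on the periodic lift, which is what `IsCn` speaks of.
-/
theorem isOpenQuotientMap_proj : IsOpenQuotientMap (proj : (Fin d → ℝ) → Torus d) :=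
  IsOpenQuotientMap.piMap fun _ => QuotientAddGroup.isOpenQuotientMap_mk

theorem continuous_proj : Continuous (proj : (Fin d → ℝ) → Torus d) :=
  isOpenQuotientMap_proj.continuous

section Smooth

variable {E : Type*} [NormedAddCommGroup E] [NormedSpace ℝ E] {n : ℕ∞}

theorem isCn_iff {f : Torus d → E} : IsCn n f ↔ ContDiff ℝ n (f ∘ proj) := Iff.rfl

theorem IsCn.continuous {f : Torus d → E} (hf : IsCn n f) : Continuous f :=
  isOpenQuotientMap_proj.isQuotientMap.continuous_iff.2 (ContDiff.continuous (isCn_iff.1 hf))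

theorem IsCn.of_le {m : ℕ∞} {f : Torus d → E} (hf : IsCn n f) (h : m ≤ n) : IsCn m f :=
  ContDiff.of_le hf (by exact_mod_cast h)

theorem IsCn.add {f g : Torus d → E} (hf : IsCn n f) (hg : IsCn n g) : IsCn n (f + g) :=
  ContDiff.add (isCn_iff.1 hf) (isCn_iff.1 hg)

theorem IsCn.const_smul {f : Torus d → E} (c : ℝ) (hf : IsCn n f) : IsCn n (c • f) :=
  ContDiff.const_smul c (isCn_iff.1 hf)

theorem isCn_const (c : E) : IsCn n (fun _ : Torus d => c) := contDiff_const

theorem IsCn.mul {f g : Torus d → ℝ} (hf : IsCn n f) (hg : IsCn n g) :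
    IsCn n (fun x => f x * g x) :=
  ContDiff.mul (isCn_iff.1 hf) (isCn_iff.1 hg)

theorem IsCn.sum {ι : Type*} {s : Finset ι} {f : ι → Torus d → E} (hf : ∀ i ∈ s, IsCn n (f i)) :
    IsCn n (fun x => ∑ i ∈ s, f i x) :=
  ContDiff.sum (f := fun i => f i ∘ proj) hf

theorem isCn_euclidean {z : Torus d → EuclideanSpace ℝ (Fin d)} :
    IsCn n z ↔ ∀ i, IsCn n (fun x => z x i) := by
  rw [isCn_iff, contDiff_euclidean]; rfl

end Smooth

/-- The bridge from the one-variable derivative on the torus to the Fréchet derivative of the lift,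
from which smoothness of partial derivatives follows. -/
theorem IsCn.partialDeriv_proj {f : Torus d → ℝ} (hf : IsCn 1 f) (i : Fin d) (y : Fin d → ℝ) :
    partialDeriv i f (proj y) = fderiv ℝ (f ∘ proj) y (Pi.single i 1) := by
  have hdiff : Differentiable ℝ (f ∘ proj) :=
    ContDiff.differentiable (isCn_iff.1 hf) (by norm_num)
  have h : (fun t : ℝ => f (proj y + Pi.single i (t : UnitAddCircle))) =
      fun t => (f ∘ proj) (y + t • Pi.single i (1 : ℝ)) := by
    funext t
    simp [proj_add, proj_single, ← Pi.single_smul]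
  unfold partialDeriv
  rw [h]
  have := (hdiff y).hasFDerivAt.hasLineDerivAt (Pi.single i 1)
  exact this.deriv

/-- The translate of a function along a coordinate direction is differentiable. -/
theorem IsCn.hasDerivAt {f : Torus d → ℝ} (hf : IsCn 1 f) (i : Fin d) (x : Torus d) (t : ℝ) :
    HasDerivAt (fun t : ℝ => f (x + Pi.single i (t : UnitAddCircle)))
      (partialDeriv i f (x + Pi.single i (t : UnitAddCircle))) t := by
  have hdiff : Differentiable ℝ (f ∘ proj) :=
    ContDiff.differentiable (isCn_iff.1 hf) (by norm_num)
  obtain ⟨y, rfl⟩ := proj_surjective x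
  have h : ∀ t : ℝ, proj y + Pi.single i (t : UnitAddCircle) =
      proj (y + t • Pi.single i (1 : ℝ)) := by
    intro t
    simp [proj_add, proj_single, ← Pi.single_smul]
  have hline : HasDerivAt (fun t : ℝ => y + t • Pi.single i (1 : ℝ))
      (Pi.single i (1 : ℝ) : Fin d → ℝ) t := by
    simpa using ((hasDerivAt_id t).smul_const (Pi.single i (1 : ℝ) : Fin d → ℝ)).const_add y
  simp_rw [h]
  rw [hf.partialDeriv_proj]
  exact (hdiff _).hasFDerivAt.comp_hasDerivAt t hline

theorem IsCn.partialDeriv {n m : ℕ∞} {f : Torus d → ℝ} (hf : IsCn n f) (h : m + 1 ≤ n)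
    (i : Fin d) : IsCn m (partialDeriv i f) := by
  have h1 : IsCn 1 f := hf.of_le (le_trans (by simp) h)
  rw [isCn_iff]
  have : TorusTV.partialDeriv i f ∘ proj = fun y => fderiv ℝ (f ∘ proj) y (Pi.single i 1) :=
    funext fun y => h1.partialDeriv_proj i y
  rw [this]
  exact (ContDiff.fderiv_right (isCn_iff.1 hf) (by exact_mod_cast h)).clm_apply contDiff_const

theorem IsCn.continuous_partialDeriv {f : Torus d → ℝ} (hf : IsCn 1 f) (i : Fin d) :
    Continuous (TorusTV.partialDeriv i f) :=
  (hf.partialDeriv (m := 0) (by simp) i).continuous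

theorem IsCn.smooth_partialDeriv {f : Torus d → ℝ} (hf : IsCn ⊤ f) (i : Fin d) :
    IsCn ⊤ (TorusTV.partialDeriv i f) :=
  hf.partialDeriv (by simp) i

theorem partialDeriv_add {f g : Torus d → ℝ} (hf : IsCn 1 f) (hg : IsCn 1 g) (i : Fin d)
    (x : Torus d) : partialDeriv i (f + g) x = partialDeriv i f x + partialDeriv i g x := by
  have := ((hf.hasDerivAt i x 0).add (hg.hasDerivAt i x 0)).deriv
  simp only [QuotientAddGroup.mk_zero, Pi.single_zero, add_zero] at this
  exact this

theorem partialDeriv_mul {f g : Torus d → ℝ} (hf : IsCn 1 f) (hg : IsCn 1 g) (i : Fin d)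
    (x : Torus d) : partialDeriv i (fun y => f y * g y) x =
      partialDeriv i f x * g x + f x * partialDeriv i g x := by
  have := ((hf.hasDerivAt i x 0).mul (hg.hasDerivAt i x 0)).deriv
  simp only [QuotientAddGroup.mk_zero, Pi.single_zero, add_zero] at this
  exact this

theorem partialDeriv_const_smul (c : ℝ) {f : Torus d → ℝ} (hf : IsCn 1 f) (i : Fin d)
    (x : Torus d) : partialDeriv i (c • f) x = c * partialDeriv i f x := by
  have := ((hf.hasDerivAt i x 0).const_mul c).deriv
  simp only [QuotientAddGroup.mk_zero, Pi.single_zero, add_zero] at this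
  exact this

theorem partialDeriv_const (c : ℝ) (i : Fin d) (x : Torus d) :
    partialDeriv i (fun _ => c) x = 0 := by
  simp [partialDeriv]

/-! ### Integration by parts -/

theorem _root_.Continuous.integrable_torus {E : Type*} [NormedAddCommGroup E]
    {f : Torus d → E} (hf : Continuous f) : Integrable f (torusMeasure d) :=
  hf.integrable_of_hasCompactSupport (HasCompactSupport.of_compactSpace f)

theorem exists_norm_bound {E : Type*} [NormedAddCommGroup E] {f : Torus d → E}
    (hf : Continuous f) : ∃ C, ∀ x, ‖f x‖ ≤ C := by
  obtain ⟨C, hC⟩ := isCompact_univ.exists_bound_of_continuousOn hf.continuousOn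
  exact ⟨C, fun x => hC x trivial⟩

/-- By translation invariance the integral of `f(x + t e_i)` does not depend on `t`; differentiate
under the integral at `t = 0`. -/
theorem integral_partialDeriv {f : Torus d → ℝ} (hf : IsCn 1 f) (i : Fin d) :
    ∫ x, partialDeriv i f x ∂(torusMeasure d) = 0 := by
  obtain ⟨C, hC⟩ := exists_norm_bound (hf.continuous_partialDeriv i)
  have h := (hasDerivAt_integral_of_dominated_loc_of_deriv_le (μ := torusMeasure d) (s := Set.univ)
    (F := fun (t : ℝ) x => f (x + Pi.single i (t : UnitAddCircle)))
    (F' := fun (t : ℝ) x => partialDeriv i f (x + Pi.single i (t : UnitAddCircle)))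
    (bound := fun _ => C) (x₀ := 0) Filter.univ_mem
    (Filter.Eventually.of_forall fun t => by
      have := hf.continuous
      exact (by fun_prop : Continuous _).aestronglyMeasurable)
    (by
      have := hf.continuous
      exact (by fun_prop : Continuous _).integrable_torus)
    (by
      have := hf.continuous_partialDeriv i
      exact (by fun_prop : Continuous _).aestronglyMeasurable)
    (Filter.Eventually.of_forall fun x t _ => hC _) (integrable_const _)
    (Filter.Eventually.of_forall fun x t _ => hf.hasDerivAt i x t)).2
  have h2 : (fun t : ℝ => ∫ x, f (x + Pi.single i (t : UnitAddCircle)) ∂(torusMeasure d)) =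
      fun _ => ∫ x, f x ∂(torusMeasure d) := by
    funext t
    exact integral_add_right_eq_self f _
  rw [h2] at h
  simpa using h.unique (hasDerivAt_const _ _)

theorem integral_mul_partialDeriv {f g : Torus d → ℝ} (hf : IsCn 1 f) (hg : IsCn 1 g)
    (i : Fin d) : ∫ x, f x * partialDeriv i g x ∂(torusMeasure d) =
      -∫ x, partialDeriv i f x * g x ∂(torusMeasure d) := by
  have h := integral_partialDeriv (hf.mul hg) i
  have hf' := hf.continuous_partialDeriv i
  have hg' := hg.continuous_partialDeriv i
  have := hf.continuous
  have := hg.continuous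
  simp_rw [partialDeriv_mul hf hg] at h
  rw [integral_add (by fun_prop : Continuous _).integrable_torus
    (by fun_prop : Continuous _).integrable_torus] at h
  linarith

theorem grad_apply (f : Torus d → ℝ) (x : Torus d) (i : Fin d) :
    grad f x i = partialDeriv i f x := rfl

theorem IsCn.continuous_grad {f : Torus d → ℝ} (hf : IsCn 1 f) : Continuous (grad f) := by
  unfold grad
  have := fun i => hf.continuous_partialDeriv i
  fun_prop

theorem inner_grad (f : Torus d → ℝ) (v : EuclideanSpace ℝ (Fin d)) (x : Torus d) :
    inner ℝ v (grad f x) = ∑ i, v i * partialDeriv i f x := by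
  rw [PiLp.inner_apply]
  refine Finset.sum_congr rfl fun i _ => ?_
  rw [grad_apply]
  simp [mul_comm]

theorem IsCn.component {n : ℕ∞} {z : Torus d → EuclideanSpace ℝ (Fin d)} (hz : IsCn n z)
    (i : Fin d) : IsCn n (fun x => z x i) := isCn_euclidean.1 hz i

theorem IsCn.continuous_divergence {z : Torus d → EuclideanSpace ℝ (Fin d)} (hz : IsCn 1 z) :
    Continuous (divergence z) :=
  continuous_finsetSum _ fun i _ => (hz.component i).continuous_partialDeriv i

theorem IsCn.divergence {z : Torus d → EuclideanSpace ℝ (Fin d)} (hz : IsCn ⊤ z) :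
    IsCn ⊤ (divergence z) :=
  IsCn.sum fun i _ => (hz.component i).smooth_partialDeriv i

theorem integral_divergence {z : Torus d → EuclideanSpace ℝ (Fin d)} (hz : IsCn 1 z) :
    ∫ x, TorusTV.divergence z x ∂(torusMeasure d) = 0 := by
  unfold TorusTV.divergence
  rw [integral_finsetSum _ fun i _ =>
    ((hz.component i).continuous_partialDeriv i).integrable_torus]
  exact Finset.sum_eq_zero fun i _ => integral_partialDeriv (hz.component i) i

/-- The divergence theorem on the torus. -/
theorem integral_mul_divergence {f : Torus d → ℝ} {z : Torus d → EuclideanSpace ℝ (Fin d)}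
    (hf : IsCn 1 f) (hz : IsCn 1 z) :
    ∫ x, f x * TorusTV.divergence z x ∂(torusMeasure d) =
      -∫ x, inner ℝ (z x) (grad f x) ∂(torusMeasure d) := by
  simp_rw [inner_grad, TorusTV.divergence, Finset.mul_sum]
  have hfc := hf.continuous
  have hf' := fun i => hf.continuous_partialDeriv i
  have hzc := fun i => (hz.component i).continuous
  have hz' := fun i => (hz.component i).continuous_partialDeriv i
  rw [integral_finsetSum _ fun i _ => ?_, integral_finsetSum _ fun i _ => ?_,
    ← Finset.sum_neg_distrib]
  · refine Finset.sum_congr rfl fun i _ => ?_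
    rw [integral_mul_partialDeriv hf (hz.component i) i]
    simp_rw [mul_comm]
  · exact ((hzc i).mul (hf' i)).integrable_torus
  · exact (hfc.mul (hz' i)).integrable_torus

/-! ### Trigonometric functions on the torus -/

/-- The function `cos (2π ξ·x)` on the torus. -/
def trigCos (ξ : Fin d → ℤ) (x : Torus d) : ℝ := (UnitAddTorus.mFourier ξ x).re

/-- The function `sin (2π ξ·x)` on the torus. -/
def trigSin (ξ : Fin d → ℤ) (x : Torus d) : ℝ := (UnitAddTorus.mFourier ξ x).im

/-- The phase `2π ξ·y`, as a linear form in `y`. -/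
def phase (ξ : Fin d → ℤ) : (Fin d → ℝ) →L[ℝ] ℝ :=
  ∑ j, (2 * Real.pi * ξ j) • ContinuousLinearMap.proj (R := ℝ) (φ := fun _ : Fin d => ℝ) j

theorem phase_apply (ξ : Fin d → ℤ) (y : Fin d → ℝ) :
    phase ξ y = ∑ j, 2 * Real.pi * ξ j * y j := by
  simp [phase]

theorem phase_single (ξ : Fin d → ℤ) (i : Fin d) (t : ℝ) :
    phase ξ (Pi.single i t) = 2 * Real.pi * ξ i * t := by
  rw [phase_apply, Finset.sum_eq_single i]
  · simp
  · intro j _ hj; simp [hj]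
  · simp

theorem mFourier_proj (ξ : Fin d → ℤ) (y : Fin d → ℝ) :
    UnitAddTorus.mFourier ξ (proj y) = Complex.exp ((phase ξ y : ℝ) * Complex.I) := by
  have : UnitAddTorus.mFourier ξ (proj y) = ∏ j, fourier (ξ j) (y j : UnitAddCircle) := rfl
  rw [this, phase_apply]
  push_cast
  rw [Finset.sum_mul, Complex.exp_sum]
  refine Finset.prod_congr rfl fun j _ => ?_
  rw [fourier_coe_apply]
  congr 1
  push_cast
  ring

theorem trigCos_proj (ξ : Fin d → ℤ) (y : Fin d → ℝ) :
    trigCos ξ (proj y) = Real.cos (phase ξ y) := by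
  rw [trigCos, mFourier_proj, Complex.exp_ofReal_mul_I_re]

theorem trigSin_proj (ξ : Fin d → ℤ) (y : Fin d → ℝ) :
    trigSin ξ (proj y) = Real.sin (phase ξ y) := by
  rw [trigSin, mFourier_proj, Complex.exp_ofReal_mul_I_im]

theorem isCn_trigCos (ξ : Fin d → ℤ) : IsCn ⊤ (trigCos ξ) := by
  rw [isCn_iff]
  have : trigCos ξ ∘ proj = fun y => Real.cos (phase ξ y) := funext (trigCos_proj ξ)
  rw [this]
  exact Real.contDiff_cos.comp (phase ξ).contDiff

theorem isCn_trigSin (ξ : Fin d → ℤ) : IsCn ⊤ (trigSin ξ) := by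
  rw [isCn_iff]
  have : trigSin ξ ∘ proj = fun y => Real.sin (phase ξ y) := funext (trigSin_proj ξ)
  rw [this]
  exact Real.contDiff_sin.comp (phase ξ).contDiff

theorem abs_trigCos_le (ξ : Fin d → ℤ) (x : Torus d) : |trigCos ξ x| ≤ 1 := by
  obtain ⟨y, rfl⟩ := proj_surjective x
  rw [trigCos_proj]; exact Real.abs_cos_le_one _

theorem abs_trigSin_le (ξ : Fin d → ℤ) (x : Torus d) : |trigSin ξ x| ≤ 1 := by
  obtain ⟨y, rfl⟩ := proj_surjective x
  rw [trigSin_proj]; exact Real.abs_sin_le_one _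

theorem trigCos_zero : trigCos (0 : Fin d → ℤ) = fun _ => 1 := by
  funext x; simp [trigCos, UnitAddTorus.mFourier_zero]

theorem trigSin_zero : trigSin (0 : Fin d → ℤ) = fun _ => 0 := by
  funext x; simp [trigSin, UnitAddTorus.mFourier_zero]

theorem partialDeriv_trigCos (ξ : Fin d → ℤ) (i : Fin d) (x : Torus d) :
    partialDeriv i (trigCos ξ) x = -(2 * Real.pi * ξ i) * trigSin ξ x := by
  obtain ⟨y, rfl⟩ := proj_surjective x
  have h : (fun t : ℝ => trigCos ξ (proj y + Pi.single i (t : UnitAddCircle))) =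
      fun t => Real.cos (phase ξ y + 2 * Real.pi * ξ i * t) := by
    funext t
    rw [← proj_single, ← proj_add, trigCos_proj, map_add, phase_single]
  have h1 : HasDerivAt (fun t : ℝ => phase ξ y + 2 * Real.pi * ξ i * t) (2 * Real.pi * ξ i) 0 := by
    simpa using ((hasDerivAt_id (0 : ℝ)).const_mul (2 * Real.pi * ξ i)).const_add (phase ξ y)
  rw [partialDeriv, h, h1.cos.deriv, trigSin_proj]
  simp only [mul_zero, add_zero]
  ring

theorem partialDeriv_trigSin (ξ : Fin d → ℤ) (i : Fin d) (x : Torus d) :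
    partialDeriv i (trigSin ξ) x = 2 * Real.pi * ξ i * trigCos ξ x := by
  obtain ⟨y, rfl⟩ := proj_surjective x
  have h : (fun t : ℝ => trigSin ξ (proj y + Pi.single i (t : UnitAddCircle))) =
      fun t => Real.sin (phase ξ y + 2 * Real.pi * ξ i * t) := by
    funext t
    rw [← proj_single, ← proj_add, trigSin_proj, map_add, phase_single]
  have h1 : HasDerivAt (fun t : ℝ => phase ξ y + 2 * Real.pi * ξ i * t) (2 * Real.pi * ξ i) 0 := by
    simpa using ((hasDerivAt_id (0 : ℝ)).const_mul (2 * Real.pi * ξ i)).const_add (phase ξ y)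
  rw [partialDeriv, h, h1.sin.deriv, trigCos_proj]
  simp only [mul_zero, add_zero]
  ring

theorem _root_.MeasureTheory.Integrable.mul_continuous_torus {h f : Torus d → ℝ}
    (hh : Integrable h (torusMeasure d)) (hf : Continuous f) :
    Integrable (fun x => h x * f x) (torusMeasure d) := by
  obtain ⟨C, hC⟩ := exists_norm_bound hf
  exact hh.mul_bdd (c := C) hf.aestronglyMeasurable (Filter.Eventually.of_forall hC)

theorem integral_mul_mFourier {h : Torus d → ℝ} (hh : Integrable h (torusMeasure d))
    (ξ : Fin d → ℤ) : ∫ x, (h x : ℂ) * UnitAddTorus.mFourier ξ x ∂(torusMeasure d) =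
      ((∫ x, h x * trigCos ξ x ∂(torusMeasure d) : ℝ) : ℂ) +
        ((∫ x, h x * trigSin ξ x ∂(torusMeasure d) : ℝ) : ℂ) * Complex.I := by
  have h1 := (hh.mul_continuous_torus (isCn_trigCos ξ).continuous)
  have h2 := (hh.mul_continuous_torus (isCn_trigSin ξ).continuous)
  rw [← integral_complex_ofReal, ← integral_complex_ofReal, ← integral_mul_const,
    ← integral_add h1.ofReal (h2.ofReal.mul_const _)]
  refine integral_congr_ae (Filter.Eventually.of_forall fun x => ?_)
  simp only [Complex.ofReal_mul]
  rw [mul_assoc, ← mul_add]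
  exact congrArg _ (Complex.re_add_im _).symm

/-- An integrable function that is orthogonal to all trigonometric functions is orthogonal to all
continuous functions. -/
theorem integral_mul_continuous_eq_zero {h : Torus d → ℝ} (hh : Integrable h (torusMeasure d))
    (hcos : ∀ ξ, ∫ x, h x * trigCos ξ x ∂(torusMeasure d) = 0)
    (hsin : ∀ ξ, ∫ x, h x * trigSin ξ x ∂(torusMeasure d) = 0)
    {f : Torus d → ℝ} (hf : Continuous f) : ∫ x, h x * f x ∂(torusMeasure d) = 0 := by
  have hint : ∀ F : C(Torus d, ℂ), Integrable (fun x => (h x : ℂ) * F x) (torusMeasure d) := by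
    intro F
    exact hh.ofReal.mul_bdd (c := ‖F‖) F.continuous.aestronglyMeasurable
      (Filter.Eventually.of_forall F.norm_coe_le_norm)
  let Λ : C(Torus d, ℂ) →L[ℂ] ℂ := LinearMap.mkContinuous
    { toFun := fun F => ∫ x, (h x : ℂ) * F x ∂(torusMeasure d)
      map_add' := fun F G => by
        rw [← integral_add (hint F) (hint G)]
        simp [mul_add]
      map_smul' := fun c F => by
        rw [RingHom.id_apply, smul_eq_mul, ← integral_const_mul]
        simp [mul_left_comm] } (∫ x, ‖h x‖ ∂(torusMeasure d)) (by
      intro F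
      refine (norm_integral_le_integral_norm _).trans ?_
      rw [← integral_mul_const]
      refine integral_mono (hint F).norm (hh.norm.mul_const _) fun x => ?_
      simp only [norm_mul, Complex.norm_real]
      exact mul_le_mul_of_nonneg_left (F.norm_coe_le_norm x) (norm_nonneg _))
  -- The kernel of `Λ` is closed and contains the exponentials, whose span is dense in the
  -- continuous functions.
  have hle : (Submodule.span ℂ (Set.range (UnitAddTorus.mFourier (d := Fin d)))).topologicalClosure
      ≤ LinearMap.ker Λ.toLinearMap := by
    refine Submodule.topologicalClosure_minimal _ ?_ (ContinuousLinearMap.isClosed_ker Λ)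
    rw [Submodule.span_le]
    rintro _ ⟨ξ, rfl⟩
    change ∫ x, (h x : ℂ) * UnitAddTorus.mFourier ξ x ∂(torusMeasure d) = 0
    rw [integral_mul_mFourier hh, hcos, hsin]
    simp
  rw [UnitAddTorus.span_mFourier_closure_eq_top] at hle
  have h0 : Λ ⟨fun x => (f x : ℂ), by fun_prop⟩ = 0 := hle Submodule.mem_top
  change ∫ x, (h x : ℂ) * (f x : ℂ) ∂(torusMeasure d) = 0 at h0
  simp_rw [← Complex.ofReal_mul] at h0
  rw [integral_complex_ofReal] at h0
  exact_mod_cast h0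

/-! ### Smooth mean-zero functions belong to the Sobolev space -/

theorem integrable_L2 (u : Lp ℝ 2 (torusMeasure d)) : Integrable u (torusMeasure d) :=
  (Lp.memLp u).integrable (by norm_num)

theorem coeff_eq_trig (u : Lp ℝ 2 (torusMeasure d)) (ξ : Fin d → ℤ) :
    coeff u ξ = ((∫ x, u x * trigCos ξ x ∂(torusMeasure d) : ℝ) : ℂ) -
        ((∫ x, u x * trigSin ξ x ∂(torusMeasure d) : ℝ) : ℂ) * Complex.I := by
  have hneg : ∀ x, UnitAddTorus.mFourier (-ξ) x = (starRingEnd ℂ) (UnitAddTorus.mFourier ξ x) :=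
    fun x => UnitAddTorus.mFourier_neg
  have hc : trigCos (-ξ) = trigCos ξ := by
    funext x; rw [trigCos, hneg, Complex.conj_re, trigCos]
  have hs : trigSin (-ξ) = fun x => -trigSin ξ x := by
    funext x; rw [trigSin, hneg, Complex.conj_im, trigSin]
  -- The coefficient at `ξ` integrates against the exponential of frequency `-ξ`; parity of cosine
  -- and sine produces the minus sign.
  have h := integral_mul_mFourier (integrable_L2 u) (-ξ)
  rw [hc, hs] at h
  simp only [mul_neg, integral_neg, Complex.ofReal_neg, neg_mul, ← sub_eq_add_neg] at h
  rw [← h]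
  refine integral_congr_ae (Filter.Eventually.of_forall fun x => ?_)
  exact mul_comm _ _

theorem _root_.Continuous.memLp_torus {E : Type*} [NormedAddCommGroup E]
    {f : Torus d → E} (hf : Continuous f) (p : ℝ≥0∞) : MemLp f p (torusMeasure d) := by
  obtain ⟨C, hC⟩ := exists_norm_bound hf
  exact MemLp.of_bound hf.aestronglyMeasurable C (Filter.Eventually.of_forall hC)

theorem freqNorm_sq (ξ : Fin d → ℤ) : freqNorm ξ ^ 2 = ∑ i, (ξ i : ℝ) ^ 2 := by
  rw [freqNorm, EuclideanSpace.norm_sq_eq]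
  simp

/-- For `s ≤ 1` the first derivatives control the `H^s` energy. The summand `1` covers `ξ = 0`,
where `0 ^ 0 = 1` if `s = 0`. -/
theorem freqNorm_rpow_le {s : ℝ≥0} (hs : s ≤ 1) (ξ : Fin d → ℤ) :
    freqNorm ξ ^ (2 * (s : ℝ)) ≤ 1 + freqNorm ξ ^ 2 := by
  have hs' : (s : ℝ) ≤ 1 := by exact_mod_cast hs
  have hs0 : (0 : ℝ) ≤ s := s.2
  by_cases h : ξ = 0
  · have h0 : freqNorm ξ = 0 := by subst h; simp [freqNorm]; rfl
    have := Real.rpow_le_one (freqNorm_nonneg ξ) (by rw [h0]; norm_num)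
      (by positivity : 0 ≤ 2 * (s : ℝ))
    nlinarith [sq_nonneg (freqNorm ξ)]
  · have := Real.rpow_le_rpow_of_exponent_le (one_le_freqNorm h)
      (by linarith : 2 * (s : ℝ) ≤ (2 : ℝ))
    rw [Real.rpow_two] at this
    linarith

theorem norm_coeff_partialDeriv {f : Torus d → ℝ} (hf : IsCn 1 f) (i : Fin d) (ξ : Fin d → ℤ)
    {u a : Lp ℝ 2 (torusMeasure d)} (hu : u =ᵐ[torusMeasure d] f)
    (ha : a =ᵐ[torusMeasure d] partialDeriv i f) :
    ‖coeff a ξ‖ = 2 * Real.pi * |(ξ i : ℝ)| * ‖coeff u ξ‖ := by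
  have h : ∀ (g k : Torus d → ℝ) (w : Torus d → ℝ), g =ᵐ[torusMeasure d] k →
      ∫ x, g x * w x ∂(torusMeasure d) = ∫ x, k x * w x ∂(torusMeasure d) := by
    intro g k w hgk
    refine integral_congr_ae ?_
    filter_upwards [hgk] with x hx
    rw [hx]
  have h1 := (isCn_trigCos ξ).of_le (m := 1) le_top
  have h2 := (isCn_trigSin ξ).of_le (m := 1) le_top
  have e1 := integral_mul_partialDeriv hf h1 i
  have e2 := integral_mul_partialDeriv hf h2 i
  simp_rw [partialDeriv_trigCos, mul_left_comm (f _) (-(2 * Real.pi * (ξ i : ℝ)))] at e1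
  simp_rw [partialDeriv_trigSin, mul_left_comm (f _) (2 * Real.pi * (ξ i : ℝ))] at e2
  rw [integral_const_mul] at e1 e2
  -- Integration by parts against cosine and sine amounts to multiplying the coefficient by `2πi
  -- ξ_i`.
  have hco : coeff a ξ = ((2 * Real.pi * ξ i : ℝ) : ℂ) * Complex.I * coeff u ξ := by
    rw [coeff_eq_trig, coeff_eq_trig, h _ _ _ hu, h _ _ _ hu, h _ _ _ ha, h _ _ _ ha,
      ← neg_eq_iff_eq_neg.2 e1, ← neg_eq_iff_eq_neg.2 e2]
    apply Complex.ext <;> simp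
  rw [hco]
  simp [abs_of_pos Real.pi_pos]

theorem summable_energy_of_isCn {s : ℝ≥0} (hs : s ≤ 1) {f : Torus d → ℝ} (hf : IsCn 1 f)
    {u : Lp ℝ 2 (torusMeasure d)} (hu : u =ᵐ[torusMeasure d] f) :
    Summable fun ξ => (1 + freqNorm ξ ^ (2 * (s : ℝ))) * ‖coeff u ξ‖ ^ 2 := by
  let a : Fin d → Lp ℝ 2 (torusMeasure d) := fun i =>
    ((hf.continuous_partialDeriv i).memLp_torus 2).toLp
  have ha : ∀ i, a i =ᵐ[torusMeasure d] partialDeriv i f := fun i => MemLp.coeFn_toLp _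
  -- One copy of `|û|²` comes from the `1` in the weight, the other from `freqNorm_rpow_le`; the
  -- factor `(2π)² ≥ 1` of the derivatives is discarded.
  have hsum : Summable fun ξ => 2 * ‖coeff u ξ‖ ^ 2 + ∑ i, ‖coeff (a i) ξ‖ ^ 2 :=
    ((coeff_sq_summable u).mul_left 2).add (summable_sum fun i _ => coeff_sq_summable (a i))
  refine Summable.of_nonneg_of_le (fun ξ => ?_) (fun ξ => ?_) hsum
  · have := Real.rpow_nonneg (freqNorm_nonneg ξ) (2 * (s : ℝ))
    positivity
  · have h1 : freqNorm ξ ^ 2 * ‖coeff u ξ‖ ^ 2 ≤ ∑ i, ‖coeff (a i) ξ‖ ^ 2 := by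
      rw [freqNorm_sq, Finset.sum_mul]
      refine Finset.sum_le_sum fun i _ => ?_
      rw [norm_coeff_partialDeriv hf i ξ hu (ha i), mul_pow, mul_pow, sq_abs]
      have hpi : 1 ≤ (2 * Real.pi) ^ 2 := by nlinarith [Real.pi_gt_three]
      have : 0 ≤ (ξ i : ℝ) ^ 2 * ‖coeff u ξ‖ ^ 2 := by positivity
      nlinarith
    have h2 := mul_le_mul_of_nonneg_right (freqNorm_rpow_le hs ξ) (sq_nonneg ‖coeff u ξ‖)
    linarith

/-- A mean-zero function of class `C^1` represents an element of `H^s_av`. -/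
theorem exists_hsAv {s : ℝ≥0} (hs : s ≤ 1) {f : Torus d → ℝ} (hf : IsCn 1 f)
    (h0 : ∫ x, f x ∂(torusMeasure d) = 0) :
    ∃ φ : HsAv d s, HsAv.toL2 φ =ᵐ[torusMeasure d] f := by
  have hu := (hf.continuous.memLp_torus 2).coeFn_toLp
  refine ⟨⟨(hf.continuous.memLp_torus 2).toLp, ?_, summable_energy_of_isCn hs hf hu⟩, hu⟩
  rw [integral_congr_ae hu, h0]

/-! ### Mollification on the torus -/

/-- The average of the translates of `f` with respect to the weight `η` on `ℝ^d`. -/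
def mollify {E : Type*} [NormedAddCommGroup E] [NormedSpace ℝ E] (η : (Fin d → ℝ) → ℝ)
    (f : Torus d → E) (x : Torus d) : E :=
  ∫ t, η t • f (x - proj t)

section Mollify

variable {E : Type*} [NormedAddCommGroup E] [NormedSpace ℝ E] {η : (Fin d → ℝ) → ℝ}
  {f : Torus d → E} {C : ℝ}

/-- The lift of the mollified function is the convolution on `ℝ^d` of `η` with the bounded periodic
lift of `f`, so it inherits the smoothness of `η`. -/
theorem isCn_mollify (hη : ContDiff ℝ (⊤ : ℕ∞) η) (hη' : HasCompactSupport η)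
    (hf : StronglyMeasurable f) (hC : ∀ x, ‖f x‖ ≤ C) : IsCn ⊤ (mollify η f) := by
  have hloc : LocallyIntegrable (f ∘ proj) (volume : Measure (Fin d → ℝ)) := by
    have : MemLp (f ∘ proj) ∞ (volume : Measure (Fin d → ℝ)) :=
      memLp_top_of_bound (hf.comp_measurable continuous_proj.measurable).aestronglyMeasurable C
        (Filter.Eventually.of_forall fun x => hC _)
    exact this.locallyIntegrable le_top
  have h := hη'.contDiff_convolution_left (n := ⊤) (ContinuousLinearMap.lsmul ℝ ℝ) hη hloc
  rw [isCn_iff]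
  refine Eq.subst (motive := fun F => ContDiff ℝ (⊤ : ℕ∞) F) ?_ h
  funext y
  simp [convolution, mollify, proj_sub]

theorem integrable_smul_translate (hη : Integrable η) (hf : StronglyMeasurable f)
    (hC : ∀ x, ‖f x‖ ≤ C) (x : Torus d) : Integrable fun t => η t • f (x - proj t) := by
  refine hη.smul_bdd C ?_ (Filter.Eventually.of_forall fun t => hC _)
  exact (hf.comp_measurable (continuous_const.sub continuous_proj).measurable).aestronglyMeasurable

theorem norm_mollify_le (hη : ∀ t, 0 ≤ η t) (hη' : Integrable η) (h1 : ∫ t, η t = 1)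
    (hC : ∀ x, ‖f x‖ ≤ C) (x : Torus d) : ‖mollify η f x‖ ≤ C := by
  refine (norm_integral_le_of_norm_le (hη'.mul_const C)
    (Filter.Eventually.of_forall fun t => ?_)).trans ?_
  · rw [norm_smul, Real.norm_of_nonneg (hη t)]
    exact mul_le_mul_of_nonneg_left (hC _) (hη t)
  · rw [integral_mul_const, h1, one_mul]

theorem mollify_apply {f : Torus d → EuclideanSpace ℝ (Fin d)} (hη : Integrable η)
    (hf : StronglyMeasurable f) (hC : ∀ x, ‖f x‖ ≤ C) (x : Torus d) (i : Fin d) :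
    mollify η f x i = mollify η (fun y => f y i) x := by
  have := (EuclideanSpace.proj (𝕜 := ℝ) i).integral_comp_comm
    (integrable_smul_translate hη hf hC x)
  simpa [mollify] using this.symm

end Mollify

/-- Mollification with an even weight is symmetric. -/
theorem integral_mollify_mul {η : (Fin d → ℝ) → ℝ} (hη : Integrable η)
    (heven : ∀ t, η (-t) = η t) {f h : Torus d → ℝ} {C : ℝ} (hf : StronglyMeasurable f)
    (hC : ∀ x, ‖f x‖ ≤ C) (hh : Continuous h) :
    ∫ x, mollify η f x * h x ∂(torusMeasure d) = ∫ x, f x * mollify η h x ∂(torusMeasure d) := by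
  obtain ⟨C', hC'⟩ := exists_norm_bound hh
  have hC0 : 0 ≤ C := (norm_nonneg _).trans (hC 0)
  have fub : ∀ (a b : Torus d × (Fin d → ℝ) → Torus d), Measurable a → Measurable b →
      Integrable (fun p : Torus d × (Fin d → ℝ) => η p.2 * (f (a p) * h (b p)))
        ((torusMeasure d).prod volume) := by
    intro a b ha hb
    have hη2 : Integrable (fun p : Torus d × (Fin d → ℝ) => η p.2)
        ((torusMeasure d).prod volume) := hη.comp_snd _
    refine hη2.mul_bdd (c := C * C') ?_ (Filter.Eventually.of_forall fun p => ?_)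
    · exact ((hf.comp_measurable ha).mul
        (hh.stronglyMeasurable.comp_measurable hb)).aestronglyMeasurable
    · rw [norm_mul]
      exact mul_le_mul (hC _) (hC' _) (norm_nonneg _) hC0
  have hproj : Measurable (proj : (Fin d → ℝ) → Torus d) := continuous_proj.measurable
  calc ∫ x, mollify η f x * h x ∂(torusMeasure d)
      = ∫ x, (∫ t, η t * (f (x - proj t) * h x)) ∂(torusMeasure d) := by
        refine integral_congr_ae (Filter.Eventually.of_forall fun x => ?_)
        simp only [mollify, smul_eq_mul]
        rw [← integral_mul_const]
        simp_rw [mul_assoc]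
    _ = ∫ t, ∫ x, η t * (f (x - proj t) * h x) ∂(torusMeasure d) :=
        integral_integral_swap (fub (fun p => p.1 - proj p.2) (fun p => p.1) (by fun_prop)
          (by fun_prop))
    -- Translation invariance in `x` moves the shift from `f` to `h`.
    _ = ∫ t, ∫ x, η t * (f x * h (x + proj t)) ∂(torusMeasure d) := by
        refine integral_congr_ae (Filter.Eventually.of_forall fun t => ?_)
        have := integral_add_right_eq_self (μ := torusMeasure d)
          (fun x => η t * (f (x - proj t) * h x)) (proj t)
        simpa using this.symm
    _ = ∫ x, (∫ t, η t * (f x * h (x + proj t))) ∂(torusMeasure d) :=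
        (integral_integral_swap (fub (fun p => p.1) (fun p => p.1 + proj p.2) (by fun_prop)
          (by fun_prop))).symm
    _ = ∫ x, f x * mollify η h x ∂(torusMeasure d) := by
        refine integral_congr_ae (Filter.Eventually.of_forall fun x => ?_)
        simp only [mollify, smul_eq_mul]
        -- Substituting `-t` for `t` turns `x + t` into `x - t`; evenness leaves the weight
        -- unchanged.
        rw [← integral_const_mul, ← integral_neg_eq_self]
        simp_rw [heven, proj_neg, ← sub_eq_add_neg, mul_left_comm]

/-! ### Mollification of trigonometric functions -/

section Multiplier

variable {η : (Fin d → ℝ) → ℝ}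

/-- The factor by which mollification multiplies the trigonometric functions of frequency `ξ`. -/
def multiplier (η : (Fin d → ℝ) → ℝ) (ξ : Fin d → ℤ) : ℝ := ∫ t, η t * Real.cos (phase ξ t)

theorem integral_mul_sin_phase (heven : ∀ t, η (-t) = η t) (ξ : Fin d → ℤ) :
    ∫ t, η t * Real.sin (phase ξ t) = 0 := by
  have h := integral_neg_eq_self (fun t => η t * Real.sin (phase ξ t)) volume
  simp_rw [heven, map_neg, Real.sin_neg, mul_neg, integral_neg] at h
  linarith

theorem integrable_mul_cos_phase (hη : Integrable η) (ξ : Fin d → ℤ) :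
    Integrable fun t => η t * Real.cos (phase ξ t) :=
  hη.mul_bdd (c := 1) (by fun_prop : Continuous _).aestronglyMeasurable
    (Filter.Eventually.of_forall fun t => Real.abs_cos_le_one _)

theorem integrable_mul_sin_phase (hη : Integrable η) (ξ : Fin d → ℤ) :
    Integrable fun t => η t * Real.sin (phase ξ t) :=
  hη.mul_bdd (c := 1) (by fun_prop : Continuous _).aestronglyMeasurable
    (Filter.Eventually.of_forall fun t => Real.abs_sin_le_one _)

/-- By the addition formula; the sine part integrates to zero against an even weight, so the
multiplier is real and does not mix cosine with sine. -/
theorem mollify_trigCos (hη : Integrable η) (heven : ∀ t, η (-t) = η t) (ξ : Fin d → ℤ)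
    (x : Torus d) : mollify η (trigCos ξ) x = multiplier η ξ * trigCos ξ x := by
  obtain ⟨y, rfl⟩ := proj_surjective x
  have h : ∀ t, η t • trigCos ξ (proj y - proj t) =
      η t * Real.cos (phase ξ t) * Real.cos (phase ξ y) +
        η t * Real.sin (phase ξ t) * Real.sin (phase ξ y) := by
    intro t
    rw [← proj_sub, trigCos_proj, map_sub, Real.cos_sub, smul_eq_mul]
    ring
  simp_rw [mollify, h]
  rw [integral_add ((integrable_mul_cos_phase hη ξ).mul_const _)
    ((integrable_mul_sin_phase hη ξ).mul_const _), integral_mul_const, integral_mul_const,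
    integral_mul_sin_phase heven, trigCos_proj, multiplier]
  ring

theorem mollify_trigSin (hη : Integrable η) (heven : ∀ t, η (-t) = η t) (ξ : Fin d → ℤ)
    (x : Torus d) : mollify η (trigSin ξ) x = multiplier η ξ * trigSin ξ x := by
  obtain ⟨y, rfl⟩ := proj_surjective x
  have h : ∀ t, η t • trigSin ξ (proj y - proj t) =
      η t * Real.cos (phase ξ t) * Real.sin (phase ξ y) -
        η t * Real.sin (phase ξ t) * Real.cos (phase ξ y) := by
    intro t
    rw [← proj_sub, trigSin_proj, map_sub, Real.sin_sub, smul_eq_mul]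
    ring
  simp_rw [mollify, h]
  rw [integral_sub ((integrable_mul_cos_phase hη ξ).mul_const _)
    ((integrable_mul_sin_phase hη ξ).mul_const _), integral_mul_const, integral_mul_const,
    integral_mul_sin_phase heven, trigSin_proj, multiplier]
  ring

theorem mollify_const_mul (c : ℝ) (f : Torus d → ℝ) (x : Torus d) :
    mollify η (fun y => c * f y) x = c * mollify η f x := by
  simp only [mollify, smul_eq_mul, mul_left_comm _ c]
  rw [integral_const_mul]

theorem abs_multiplier_le (hη : ∀ t, 0 ≤ η t) (hη' : Integrable η) (h1 : ∫ t, η t = 1)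
    (ξ : Fin d → ℤ) : |multiplier η ξ| ≤ 1 := by
  rw [← h1, multiplier, ← Real.norm_eq_abs]
  refine norm_integral_le_of_norm_le hη' (Filter.Eventually.of_forall fun t => ?_)
  rw [norm_mul, Real.norm_of_nonneg (hη t)]
  exact mul_le_of_le_one_right (hη t) (Real.abs_cos_le_one _)

end Multiplier

/-- Even smooth weights of integral one that concentrate at the origin. -/
theorem exists_mollifiers (d : ℕ) : ∃ η : ℕ → (Fin d → ℝ) → ℝ,
    (∀ n, ContDiff ℝ (⊤ : ℕ∞) (η n)) ∧ (∀ n, HasCompactSupport (η n)) ∧ (∀ n t, 0 ≤ η n t) ∧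
    (∀ n, ∫ t, η n t = 1) ∧ (∀ n t, η n (-t) = η n t) ∧
    ∀ ξ, Filter.Tendsto (fun n => multiplier (η n) ξ) Filter.atTop (nhds 1) := by
  let φ : ℕ → ContDiffBump (0 : Fin d → ℝ) := fun n =>
    ⟨1 / ((n : ℝ) + 1) / 2, 1 / ((n : ℝ) + 1), by positivity, half_lt_self (by positivity)⟩
  have hφ : Filter.Tendsto (fun n => (φ n).rOut) Filter.atTop (nhds 0) :=
    tendsto_one_div_add_atTop_nhds_zero_nat
  refine ⟨fun n => (φ n).normed volume, fun n => (φ n).contDiff_normed,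
    fun n => (φ n).hasCompactSupport_normed, fun n => (φ n).nonneg_normed,
    fun n => (φ n).integral_normed, fun n t => (φ n).normed_neg t, fun ξ => ?_⟩
  -- The multiplier is the value at the origin of the bump convolved with `cos (phase ξ ·)`, and
  -- that cosine equals `1` there.
  have h := ContDiffBump.convolution_tendsto_right_of_continuous (μ := volume) hφ
    (by fun_prop : Continuous fun t : Fin d → ℝ => Real.cos (phase ξ t)) 0
  simpa [convolution, multiplier] using h

/-! ### Smooth approximation of bounded fields whose divergence is in the Sobolev space -/

theorem ae_norm_le_of_boundedField (z : BoundedField d) :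
    ∀ᵐ x ∂(torusMeasure d), ‖z x‖ ≤ ‖z‖ := by
  filter_upwards [enorm_ae_le_eLpNormEssSup z (torusMeasure d)] with x hx
  rw [← eLpNorm_exponent_top, ← Lp.enorm_def, enorm_le_iff_norm_le] at hx
  exact hx

/-- The fields in `totalVariation` are bounded at every point, and `norm_mollify_le` gives this from
a bound on the mollified field that also holds everywhere. -/
theorem exists_bounded_representative (z : BoundedField d) :
    ∃ ζ : Torus d → EuclideanSpace ℝ (Fin d), StronglyMeasurable ζ ∧ (∀ x, ‖ζ x‖ ≤ ‖z‖) ∧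
      z =ᵐ[torusMeasure d] ζ := by
  have hm := Lp.stronglyMeasurable z
  refine ⟨{x | ‖z x‖ ≤ ‖z‖}.indicator z, hm.indicator
    (measurableSet_le hm.norm.measurable measurable_const), fun x => ?_, ?_⟩
  · by_cases h : ‖z x‖ ≤ ‖z‖
    · rw [Set.indicator_of_mem (by exact h)]; exact h
    · rw [Set.indicator_of_notMem (by exact h)]; simp
  · filter_upwards [ae_norm_le_of_boundedField z] with x hx
    rw [Set.indicator_of_mem (by exact hx)]

/-- If mollification multiplies the gradient of `ψ` by `α`, then it multiplies the action of the
divergence on `ψ` by `α`. -/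
theorem integral_divergence_mollify {η : (Fin d → ℝ) → ℝ} (hη : ContDiff ℝ (⊤ : ℕ∞) η)
    (hη' : HasCompactSupport η) (heven : ∀ t, η (-t) = η t) {z : BoundedField d}
    {ζ : Torus d → EuclideanSpace ℝ (Fin d)} {C : ℝ} (hζ : StronglyMeasurable ζ)
    (hC : ∀ x, ‖ζ x‖ ≤ C) (hz : z =ᵐ[torusMeasure d] ζ) {p : Lp ℝ 2 (torusMeasure d)}
    (hp : HasDiv z p) {ψ : Torus d → ℝ} (hψ : IsCn ⊤ ψ) {α : ℝ}
    (hα : ∀ i x, mollify η (partialDeriv i ψ) x = α * partialDeriv i ψ x) :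
    ∫ x, divergence (mollify η ζ) x * ψ x ∂(torusMeasure d) =
      α * ∫ x, p x * ψ x ∂(torusMeasure d) := by
  have hηi : Integrable η := hη.continuous.integrable_of_hasCompactSupport hη'
  have hZ := isCn_mollify hη hη' hζ hC
  have hψ1 : IsCn 1 ψ := hψ.of_le le_top
  have hψ' := fun i => hψ1.continuous_partialDeriv i
  have hζi : ∀ i, StronglyMeasurable fun x => ζ x i := fun i =>
    (EuclideanSpace.proj (𝕜 := ℝ) i).continuous.comp_stronglyMeasurable hζ
  have hCi : ∀ i x, ‖ζ x i‖ ≤ C := fun i x => (PiLp.norm_apply_le (ζ x) i).trans (hC x)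
  have hint : ∀ i, Integrable (fun x => ζ x i * partialDeriv i ψ x) (torusMeasure d) := fun i =>
    Integrable.mul_continuous_torus
      (Integrable.of_bound (hζi i).aestronglyMeasurable C (Filter.Eventually.of_forall (hCi i)))
      (hψ' i)
  simp_rw [mul_comm (divergence _ _)]
  rw [integral_mul_divergence hψ1 (hZ.of_le le_top)]
  have h2 : ∫ x, p x * ψ x ∂(torusMeasure d) =
      -∫ x, inner ℝ (ζ x) (grad ψ x) ∂(torusMeasure d) := by
    rw [← neg_eq_iff_eq_neg, ← hp ψ hψ]
    refine integral_congr_ae ?_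
    filter_upwards [hz] with x hx
    rw [hx]
  rw [h2, mul_neg]
  congr 1
  simp_rw [inner_grad]
  rw [integral_finsetSum _ fun i _ => hint i, integral_finsetSum _ fun i _ => ?_, Finset.mul_sum]
  · refine Finset.sum_congr rfl fun i _ => ?_
    simp_rw [mollify_apply hηi hζ hC]
    rw [integral_mollify_mul hηi heven (hζi i) (hCi i) (hψ' i), ← integral_const_mul]
    simp_rw [hα, mul_left_comm]
  · exact (((hZ.component i).continuous).mul (hψ' i)).integrable_torus

/-- Partial derivatives of cosine and sine are multiples of sine and cosine of the same frequency,
so `integral_divergence_mollify` applies to both with the factor `multiplier η ξ`. -/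
theorem coeff_divergence_mollify {η : (Fin d → ℝ) → ℝ} (hη : ContDiff ℝ (⊤ : ℕ∞) η)
    (hη' : HasCompactSupport η) (heven : ∀ t, η (-t) = η t) {z : BoundedField d}
    {ζ : Torus d → EuclideanSpace ℝ (Fin d)} {C : ℝ} (hζ : StronglyMeasurable ζ)
    (hC : ∀ x, ‖ζ x‖ ≤ C) (hz : z =ᵐ[torusMeasure d] ζ) {p P : Lp ℝ 2 (torusMeasure d)}
    (hp : HasDiv z p) (hP : P =ᵐ[torusMeasure d] divergence (mollify η ζ)) (ξ : Fin d → ℤ) :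
    coeff P ξ = multiplier η ξ * coeff p ξ := by
  have hηi : Integrable η := hη.continuous.integrable_of_hasCompactSupport hη'
  have key : ∀ ψ : Torus d → ℝ, IsCn ⊤ ψ →
      (∀ i x, mollify η (partialDeriv i ψ) x = multiplier η ξ * partialDeriv i ψ x) →
      ∫ x, P x * ψ x ∂(torusMeasure d) =
        multiplier η ξ * ∫ x, p x * ψ x ∂(torusMeasure d) := by
    intro ψ hψ hα
    rw [← integral_divergence_mollify hη hη' heven hζ hC hz hp hψ hα]
    refine integral_congr_ae ?_
    filter_upwards [hP] with x hx
    rw [hx]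
  rw [coeff_eq_trig, coeff_eq_trig, key _ (isCn_trigCos ξ), key _ (isCn_trigSin ξ)]
  · push_cast; ring
  · intro i x
    rw [funext (partialDeriv_trigSin ξ i), mollify_const_mul, mollify_trigCos hηi heven]
    ring
  · intro i x
    rw [funext (partialDeriv_trigCos ξ i), mollify_const_mul, mollify_trigSin hηi heven]
    ring

theorem HsAv.summable_weighted_sq {s : ℝ≥0} (u : HsAv d s) :
    Summable fun ξ => ‖HsAv.weighted u ξ‖ ^ 2 := by
  simpa using (lp.memℓp (HsAv.weighted u)).summable (by norm_num)

/-- Weak convergence in `H^s_av` under Fourier multipliers bounded by one that tend to one. -/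
theorem tendsto_inner_of_multiplier {s : ℝ≥0} (q p : HsAv d s) (P : ℕ → HsAv d s)
    (α : ℕ → (Fin d → ℤ) → ℝ) (hα : ∀ n ξ, |α n ξ| ≤ 1)
    (hα1 : ∀ ξ, Filter.Tendsto (fun n => α n ξ) Filter.atTop (nhds 1))
    (hP : ∀ n ξ, coeff (HsAv.toL2 (P n)) ξ = α n ξ * coeff (HsAv.toL2 p) ξ) :
    Filter.Tendsto (fun n => inner ℝ q (P n)) Filter.atTop (nhds (inner ℝ q p)) := by
  have hterm : ∀ n ξ, freqNorm ξ ^ (2 * (s : ℝ)) *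
      (coeff (HsAv.toL2 q) ξ * (starRingEnd ℂ) (coeff (HsAv.toL2 (P n)) ξ)).re =
      α n ξ * (freqNorm ξ ^ (2 * (s : ℝ)) *
        (coeff (HsAv.toL2 q) ξ * (starRingEnd ℂ) (coeff (HsAv.toL2 p) ξ)).re) := by
    intro n ξ
    rw [hP, map_mul, Complex.conj_ofReal, mul_left_comm (coeff _ _), Complex.re_ofReal_mul]
    ring
  simp_rw [HsAv.inner_eq_tsum, hterm]
  -- The terms are at most `|ab|` with `a`, `b` the weighted coefficients of `q` and `p`, and `|ab|
  -- ≤ a² + b²` is summable.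
  refine tendsto_tsum_of_dominated_convergence
    (bound := fun ξ => ‖HsAv.weighted q ξ‖ ^ 2 + ‖HsAv.weighted p ξ‖ ^ 2)
    ((HsAv.summable_weighted_sq q).add (HsAv.summable_weighted_sq p)) (fun ξ => ?_)
    (Filter.Eventually.of_forall fun n ξ => ?_)
  · simpa using (hα1 ξ).mul_const _
  · have h1 : ‖freqNorm ξ ^ (2 * (s : ℝ)) *
        (coeff (HsAv.toL2 q) ξ * (starRingEnd ℂ) (coeff (HsAv.toL2 p) ξ)).re‖ ≤
        ‖HsAv.weighted q ξ‖ * ‖HsAv.weighted p ξ‖ := by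
      have hnn := Real.rpow_nonneg (freqNorm_nonneg ξ) (s : ℝ)
      rw [HsAv.weighted_apply, HsAv.weighted_apply, sobolevWeight_bound, norm_mul, norm_mul,
        norm_mul, Complex.norm_real, norm_pow, Real.norm_of_nonneg hnn]
      have h2 := Complex.abs_re_le_norm
        (coeff (HsAv.toL2 q) ξ * (starRingEnd ℂ) (coeff (HsAv.toL2 p) ξ))
      rw [norm_mul, RCLike.norm_conj] at h2
      calc _ ≤ (freqNorm ξ ^ (s : ℝ)) ^ 2 * (‖coeff (HsAv.toL2 q) ξ‖ * ‖coeff (HsAv.toL2 p) ξ‖) :=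
            mul_le_mul_of_nonneg_left h2 (sq_nonneg _)
        _ = _ := by ring
    rw [norm_mul]
    have h3 : ‖α n ξ‖ ≤ 1 := hα n ξ
    have := mul_le_mul h3 h1 (norm_nonneg _) zero_le_one
    nlinarith [sq_nonneg (‖HsAv.weighted q ξ‖ - ‖HsAv.weighted p ξ‖)]

/-! ### The bound of the pairing by `‖z‖_∞` times the total variation -/

theorem innerNeg_neg_fracLaplacian {s : ℝ≥0} (w : HNegAv d s) (p : HsAv d s) :
    innerNeg w (-fracLaplacian d s p) = -w p := by
  obtain ⟨q, rfl⟩ := (fracLaplacian d s).surjective w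
  rw [innerNeg, LinearIsometryEquiv.symm_apply_apply, neg_apply,
    fracLaplacian, InnerProductSpace.toDual_apply_apply, InnerProductSpace.toDual_apply_apply,
    real_inner_comm]

theorem divergence_const_smul (c : ℝ) {z : Torus d → EuclideanSpace ℝ (Fin d)} (hz : IsCn 1 z)
    (x : Torus d) : divergence (c • z) x = c * divergence z x := by
  unfold divergence
  rw [Finset.mul_sum]
  exact Finset.sum_congr rfl fun i _ => partialDeriv_const_smul c (hz.component i) i x

/-- Rescale the field to the unit ball by `M⁻¹`; for `M = 0` the field itself vanishes. -/
theorem ofReal_integral_mul_divergence_le {g : Torus d → ℝ} {z : Torus d → EuclideanSpace ℝ (Fin d)}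
    (hz : IsCn 1 z) {M : ℝ≥0} (hM : ∀ x, ‖z x‖ ≤ M) :
    ENNReal.ofReal (∫ x, g x * divergence z x ∂(torusMeasure d)) ≤ M * totalVariation g := by
  rcases eq_or_ne M 0 with rfl | hM0
  · have h0 : z = fun _ => 0 := funext fun x => norm_le_zero_iff.1 (by simpa using hM x)
    subst h0
    simp [divergence, partialDeriv]
  · have hMr : (0 : ℝ) < M := by positivity
    have hle : ENNReal.ofReal (∫ x, g x * divergence ((M : ℝ)⁻¹ • z) x ∂(torusMeasure d)) ≤
        totalVariation g := by
      refine le_iSup₂_of_le ((M : ℝ)⁻¹ • z) (hz.const_smul _) (le_iSup_of_le (fun x => ?_) le_rfl)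
      rw [Pi.smul_apply, norm_smul, norm_inv, Real.norm_of_nonneg hMr.le, inv_mul_le_one₀ hMr]
      exact hM x
    simp_rw [divergence_const_smul _ hz, mul_left_comm _ (M : ℝ)⁻¹] at hle
    rw [integral_const_mul] at hle
    calc _ = ENNReal.ofReal (M * ((M : ℝ)⁻¹ * ∫ x, g x * divergence z x ∂(torusMeasure d))) := by
          rw [mul_inv_cancel_left₀ hMr.ne']
      _ = M * ENNReal.ofReal ((M : ℝ)⁻¹ * ∫ x, g x * divergence z x ∂(torusMeasure d)) := by
          rw [ENNReal.ofReal_mul hMr.le, ENNReal.ofReal_coe_nnreal]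
      _ ≤ _ := by gcongr

/-- The duality pairing of a function with `-(-Δ_av)^s div z` is at most `‖z‖_∞` times its total
variation. -/
theorem ofReal_innerNeg_le {s : ℝ≥0} (hs : s ≤ 1) {w v : HNegAv d s} {g : Torus d → ℝ}
    (hg : IsFunction w g) {z : BoundedField d} (hz : IsFluxOf z v) :
    ENNReal.ofReal (innerNeg w v) ≤ ‖z‖ₑ * totalVariation g := by
  obtain ⟨p, hp, rfl⟩ := hz
  obtain ⟨ζ, hζ, hC, hzζ⟩ := exists_bounded_representative z
  obtain ⟨η, hη, hη', hpos, hone, heven, hlim⟩ := exists_mollifiers d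
  have hηi := fun n => (hη n).continuous.integrable_of_hasCompactSupport (hη' n) (μ := volume)
  have hZ := fun n => isCn_mollify (hη n) (hη' n) hζ hC
  have hZ1 := fun n => (hZ n).of_le (m := 1) le_top
  have hdiv1 := fun n => (IsCn.divergence (hZ n)).of_le (m := 1) le_top
  choose P hP using fun n => exists_hsAv hs (hdiv1 n) (integral_divergence (hZ1 n))
  have htend : Filter.Tendsto (fun n => w (P n)) Filter.atTop (nhds (w p)) := by
    -- With `q` the Riesz representative of `w`, weak convergence of the divergences suffices.
    obtain ⟨q, rfl⟩ := (fracLaplacian d s).surjective w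
    exact tendsto_inner_of_multiplier q p P (fun n => multiplier (η n))
      (fun n => abs_multiplier_le (hpos n) (hηi n) (hone n)) hlim
      (fun n => coeff_divergence_mollify (hη n) (hη' n) (heven n) hζ hC hzζ hp (hP n))
  rw [innerNeg_neg_fracLaplacian]
  refine le_of_tendsto ((ENNReal.continuous_ofReal.tendsto _).comp htend.neg)
    (Filter.Eventually.of_forall fun n => ?_)
  -- The divergence of the mollified field is smooth with mean zero, so it is a legitimate test
  -- function for `IsFunction`; the sign is absorbed in the field.
  have h1 : -w (P n) = ∫ x, g x * divergence ((-1 : ℝ) • mollify (η n) ζ) x ∂(torusMeasure d) := by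
    rw [hg.2.2 _ _ (IsCn.divergence (hZ n)) (hP n)]
    simp_rw [divergence_const_smul _ (hZ1 n)]
    simp [integral_neg]
  simp only [Function.comp]
  rw [h1]
  refine ofReal_integral_mul_divergence_le (M := ‖z‖₊) ((hZ1 n).const_smul _) fun x => ?_
  rw [Pi.smul_apply, norm_smul, norm_neg, norm_one, one_mul]
  exact norm_mollify_le (hpos n) (hηi n) (hone n) hC x

variable {s : ℝ≥0}

/-! ### The functional `Φ` is the total variation of any representative -/

theorem integral_trigCos {ξ : Fin d → ℤ} (h : ξ ≠ 0) :
    ∫ x, trigCos ξ x ∂(torusMeasure d) = 0 := by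
  obtain ⟨i, hi⟩ := Function.ne_iff.mp h
  have h1 := integral_partialDeriv ((isCn_trigSin ξ).of_le le_top) i
  simp_rw [partialDeriv_trigSin] at h1
  rw [integral_const_mul] at h1
  have hi' : (ξ i : ℝ) ≠ 0 := by exact_mod_cast hi
  exact (mul_eq_zero.1 h1).resolve_left (by positivity)

theorem integral_trigSin (ξ : Fin d → ℤ) : ∫ x, trigSin ξ x ∂(torusMeasure d) = 0 := by
  by_cases h : ξ = 0
  · subst h; simp [trigSin_zero]
  obtain ⟨i, hi⟩ := Function.ne_iff.mp h
  have h1 := integral_partialDeriv ((isCn_trigCos ξ).of_le le_top) i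
  simp_rw [partialDeriv_trigCos] at h1
  rw [integral_const_mul] at h1
  have hi' : (ξ i : ℝ) ≠ 0 := by exact_mod_cast hi
  exact (mul_eq_zero.1 h1).resolve_left (neg_ne_zero.2 (by positivity))

theorem IsFunction.apply_eq (hs : s ≤ 1) {u : HNegAv d s} {g g' : Torus d → ℝ}
    (hg : IsFunction u g) (hg' : IsFunction u g') {ψ : Torus d → ℝ} (hψ : IsCn ⊤ ψ)
    (h0 : ∫ x, ψ x ∂(torusMeasure d) = 0) :
    ∫ x, g x * ψ x ∂(torusMeasure d) = ∫ x, g' x * ψ x ∂(torusMeasure d) := by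
  obtain ⟨φ, hφ⟩ := exists_hsAv hs (hψ.of_le le_top) h0
  rw [← hg.2.2 φ ψ hψ hφ, ← hg'.2.2 φ ψ hψ hφ]

/-- Two functions that represent the same element of `H^{-s}_av` act in the same way on continuous
functions. -/
theorem IsFunction.integral_mul_eq (hs : s ≤ 1) {u : HNegAv d s} {g g' : Torus d → ℝ}
    (hg : IsFunction u g) (hg' : IsFunction u g') {f : Torus d → ℝ} (hf : Continuous f) :
    ∫ x, g x * f x ∂(torusMeasure d) = ∫ x, g' x * f x ∂(torusMeasure d) := by
  have hsub : ∀ {f : Torus d → ℝ}, Continuous f → ∫ x, (g - g') x * f x ∂(torusMeasure d) =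
      ∫ x, g x * f x ∂(torusMeasure d) - ∫ x, g' x * f x ∂(torusMeasure d) := by
    intro f hf
    rw [← integral_sub (hg.1.mul_continuous_torus hf) (hg'.1.mul_continuous_torus hf)]
    simp [sub_mul]
  have h := integral_mul_continuous_eq_zero (hg.1.sub hg'.1) (fun ξ => ?_) (fun ξ => ?_) hf
  · rw [hsub hf] at h
    exact sub_eq_zero.1 h
  · rw [hsub (isCn_trigCos ξ).continuous]
    -- Constants are not among the test functions of `IsFunction`; at frequency zero both integrals
    -- vanish by the mean-zero condition.
    by_cases hξ : ξ = 0
    · subst hξ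
      simp [trigCos_zero, hg.2.1, hg'.2.1]
    · rw [hg.apply_eq hs hg' (isCn_trigCos ξ) (integral_trigCos hξ), sub_self]
  · rw [hsub (isCn_trigSin ξ).continuous,
      hg.apply_eq hs hg' (isCn_trigSin ξ) (integral_trigSin ξ), sub_self]

/-- The divergence of a `C^1` field is only continuous, whereas `IsFunction` tests smooth functions;
`IsFunction.integral_mul_eq` closes the gap. -/
theorem Phi_eq_totalVariation (hs : s ≤ 1) {u : HNegAv d s} {g : Torus d → ℝ}
    (hg : IsFunction u g) : Phi u = totalVariation g := by
  have h : ∀ g', IsFunction u g' → totalVariation g' = totalVariation g := by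
    intro g' hg'
    unfold totalVariation
    refine iSup_congr fun z => iSup_congr fun hz => ?_
    rw [hg.integral_mul_eq hs hg' (IsCn.continuous_divergence hz)]
  refine le_antisymm (iInf₂_le g hg) (le_iInf₂ fun g' hg' => (h g' hg').ge)

theorem ofReal_innerNeg_le_Phi (hs : s ≤ 1) (w : HNegAv d s) {v : HNegAv d s}
    {z : BoundedField d} (hz : IsFluxOf z v) (hfin : Phi w ≠ ∞) :
    ENNReal.ofReal (innerNeg w v) ≤ ‖z‖ₑ * Phi w := by
  have : ∃ g, IsFunction w g := by
    by_contra! h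
    exact hfin (by simp [Phi, h])
  obtain ⟨g, hg⟩ := this
  rw [Phi_eq_totalVariation hs hg]
  exact ofReal_innerNeg_le hs hg hz

/-! ### Functions of vanishing total variation -/

theorem integral_mul_divergence_eq_zero {g : Torus d → ℝ} (hg : totalVariation g = 0)
    {z : Torus d → EuclideanSpace ℝ (Fin d)} (hz : IsCn 1 z) (h1 : ∀ x, ‖z x‖ ≤ 1) :
    ∫ x, g x * divergence z x ∂(torusMeasure d) = 0 := by
  have hle : ∀ ζ : Torus d → EuclideanSpace ℝ (Fin d), IsCn 1 ζ → (∀ x, ‖ζ x‖ ≤ 1) →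
      ∫ x, g x * divergence ζ x ∂(torusMeasure d) ≤ 0 := by
    intro ζ hζ hζ1
    have := ofReal_integral_mul_divergence_le (g := g) hζ (M := 1) (by simpa using hζ1)
    rw [hg, mul_zero] at this
    simpa using this
  refine le_antisymm (hle z hz h1) ?_
  have h2 := hle ((-1 : ℝ) • z) (hz.const_smul _) (fun x => by simpa using h1 x)
  simp_rw [divergence_const_smul _ hz] at h2
  simp only [neg_mul, one_mul, mul_neg, integral_neg] at h2
  linarith

theorem isCn_single {n : ℕ∞} {f : Torus d → ℝ} (hf : IsCn n f) (i : Fin d) :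
    IsCn n (fun x => (EuclideanSpace.single i (f x) : EuclideanSpace ℝ (Fin d))) := by
  rw [isCn_euclidean]
  intro j
  by_cases h : j = i
  · subst h; simpa using hf
  · simpa [h] using isCn_const 0

theorem divergence_single (f : Torus d → ℝ) (i : Fin d) (x : Torus d) :
    divergence (fun y => (EuclideanSpace.single i (f y) : EuclideanSpace ℝ (Fin d))) x =
      partialDeriv i f x := by
  unfold divergence
  rw [Finset.sum_eq_single i]
  · simp
  · intro j _ hj
    simp [hj, partialDeriv_const]
  · simp

/-- For `ξ_i ≠ 0`, the fields `sin(2π ξ·x) e_i` and `cos(2π ξ·x) e_i` have divergences that are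
nonzero multiples of cosine and sine. Hence all nonzero frequencies of `g` vanish, and frequency
zero vanishes by the mean condition. -/
theorem integral_mul_eq_zero_of_totalVariation {g : Torus d → ℝ}
    (hg : Integrable g (torusMeasure d)) (hg0 : ∫ x, g x ∂(torusMeasure d) = 0)
    (hTV : totalVariation g = 0) {f : Torus d → ℝ} (hf : Continuous f) :
    ∫ x, g x * f x ∂(torusMeasure d) = 0 := by
  refine integral_mul_continuous_eq_zero hg (fun ξ => ?_) (fun ξ => ?_) hf
  · by_cases hξ : ξ = 0
    · subst hξ; simpa [trigCos_zero] using hg0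
    obtain ⟨i, hi⟩ := Function.ne_iff.mp hξ
    have hi' : (ξ i : ℝ) ≠ 0 := by exact_mod_cast hi
    have h := integral_mul_divergence_eq_zero hTV
      (isCn_single ((isCn_trigSin ξ).of_le le_top) i) (fun x => by
        simpa using abs_trigSin_le ξ x)
    simp_rw [divergence_single, partialDeriv_trigSin,
      mul_left_comm (g _) (2 * Real.pi * (ξ i : ℝ))] at h
    rw [integral_const_mul] at h
    exact (mul_eq_zero.1 h).resolve_left (by positivity)
  · by_cases hξ : ξ = 0
    · subst hξ; simp [trigSin_zero]
    obtain ⟨i, hi⟩ := Function.ne_iff.mp hξ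
    have hi' : (ξ i : ℝ) ≠ 0 := by exact_mod_cast hi
    have h := integral_mul_divergence_eq_zero hTV
      (isCn_single ((isCn_trigCos ξ).of_le le_top) i) (fun x => by
        simpa using abs_trigCos_le ξ x)
    simp_rw [divergence_single, partialDeriv_trigCos,
      mul_left_comm (g _) (-(2 * Real.pi * (ξ i : ℝ)))] at h
    rw [integral_const_mul] at h
    exact (mul_eq_zero.1 h).resolve_left (neg_ne_zero.2 (by positivity))

/-! ### Square integrable functions as elements of the dual space -/

/-- The functional `h ↦ ∫ a h` on `H^s_av`. -/
def ofL2 (a : Lp ℝ 2 (torusMeasure d)) : HNegAv d s :=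
  ((innerSL ℝ a).toLinearMap ∘ₗ HsAv.toL2).mkContinuous ‖a‖ fun h =>
    (norm_inner_le_norm a _).trans
      (mul_le_mul_of_nonneg_left (HsAv.norm_toL2_le h) (norm_nonneg a))

theorem ofL2_apply (a : Lp ℝ 2 (torusMeasure d)) (h : HsAv d s) :
    ofL2 a h = ∫ x, a x * HsAv.toL2 h x ∂(torusMeasure d) := by
  change inner ℝ a (HsAv.toL2 h) = _
  rw [L2.inner_def]
  simp [mul_comm]

theorem ofL2_apply_of_ae {a : Lp ℝ 2 (torusMeasure d)} {f ψ : Torus d → ℝ}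
    (ha : a =ᵐ[torusMeasure d] f) (h : HsAv d s) (hψ : HsAv.toL2 h =ᵐ[torusMeasure d] ψ) :
    ofL2 a h = ∫ x, f x * ψ x ∂(torusMeasure d) := by
  rw [ofL2_apply]
  refine integral_congr_ae ?_
  filter_upwards [ha, hψ] with x h1 h2
  rw [h1, h2]

theorem isFunction_ofL2 {a : Lp ℝ 2 (torusMeasure d)} {f : Torus d → ℝ}
    (ha : a =ᵐ[torusMeasure d] f) (h0 : ∫ x, f x ∂(torusMeasure d) = 0) :
    IsFunction (ofL2 a : HNegAv d s) f :=
  ⟨(integrable_L2 a).congr ha, h0, fun φ _ _ hψ => ofL2_apply_of_ae ha φ hψ⟩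

theorem fracLaplacian_neg (p : HsAv d s) : fracLaplacian d s (-p) = -fracLaplacian d s p :=
  (fracLaplacian d s).toLinearEquiv.map_neg p

theorem innerNeg_ofL2 (a : Lp ℝ 2 (torusMeasure d)) (v : HNegAv d s) :
    innerNeg (ofL2 a) v =
      ∫ x, a x * HsAv.toL2 ((fracLaplacian d s).symm v) x ∂(torusMeasure d) := by
  have hv : v = -fracLaplacian d s (-(fracLaplacian d s).symm v) := by
    rw [fracLaplacian_neg, neg_neg, LinearIsometryEquiv.apply_symm_apply]
  rw [← ofL2_apply]
  conv_lhs => rw [hv]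
  rw [innerNeg_neg_fracLaplacian, map_neg, neg_neg]

/-- Integration by parts and Cauchy-Schwarz. Equality holds too, but only this direction is needed.
-/
theorem totalVariation_le {f : Torus d → ℝ} (hf : IsCn 1 f) :
    totalVariation f ≤ ENNReal.ofReal (∫ x, ‖grad f x‖ ∂(torusMeasure d)) := by
  refine iSup_le fun z => iSup₂_le fun hz h1 => ENNReal.ofReal_le_ofReal ?_
  rw [integral_mul_divergence hf hz, ← integral_neg]
  have hz' := hz.continuous
  have hf' := hf.continuous_grad
  refine integral_mono (by fun_prop : Continuous _).integrable_torus
    (by fun_prop : Continuous _).integrable_torus fun x => ?_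
  have h2 := neg_le_of_abs_le (abs_real_inner_le_norm (z x) (grad f x))
  have h3 := mul_le_mul_of_nonneg_right (h1 x) (norm_nonneg (grad f x))
  simp only
  linarith

/-! ### Construction of a flux by the Hahn-Banach theorem -/

/-- A form of Hahn-Banach for a functional given on parameters `x` rather than on the vectors `A x`.
The bound at `x` and `-x` makes `l` vanish on the kernel of `A`, so `l` descends to the range. -/
theorem exists_extension_along {V S : Type*} [AddCommGroup V] [Module ℝ V] [AddCommGroup S]
    [Module ℝ S] (A : S →ₗ[ℝ] V) (l : S →ₗ[ℝ] ℝ) (N : V → ℝ)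
    (hom : ∀ c : ℝ, 0 < c → ∀ x, N (c • x) = c * N x) (hadd : ∀ x y, N (x + y) ≤ N x + N y)
    (hle : ∀ x, l x ≤ N (A x)) :
    ∃ f : V →ₗ[ℝ] ℝ, (∀ x, f (A x) = l x) ∧ ∀ F, f F ≤ N F := by
  have hN0 : N 0 = 0 := by
    have := hom 2 two_pos 0
    rw [smul_zero] at this
    linarith
  have hker : LinearMap.ker A ≤ LinearMap.ker l := by
    intro x hx
    rw [LinearMap.mem_ker] at hx ⊢
    have h1 := hle x
    have h2 := hle (-x)
    rw [map_neg, map_neg, hx, neg_zero, hN0] at h2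
    rw [hx, hN0] at h1
    linarith
  let l' : V →ₗ.[ℝ] ℝ :=
    ⟨LinearMap.range A, (LinearMap.ker A).liftQ l hker ∘ₗ A.quotKerEquivRange.symm.toLinearMap⟩
  have hl' : ∀ x : S, l' ⟨A x, x, rfl⟩ = l x := by
    intro x
    change (LinearMap.ker A).liftQ l hker (A.quotKerEquivRange.symm ⟨A x, x, rfl⟩) = l x
    have : A.quotKerEquivRange.symm ⟨A x, LinearMap.mem_range_self A x⟩ =
        (LinearMap.ker A).mkQ x := A.quotKerEquivRange_symm_apply_image x _
    rw [this, Submodule.mkQ_apply, Submodule.liftQ_apply]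
  obtain ⟨f, hf, hfN⟩ := exists_extension_of_le_sublinear l' N hom hadd (by
    rintro ⟨_, x, rfl⟩
    rw [hl']
    exact hle x)
  exact ⟨f, fun x => (hf ⟨A x, x, rfl⟩).trans (hl' x), hfN⟩

/-- A square integrable field that acts as a bounded functional for the `L^1` norm is bounded. -/
theorem ae_norm_le_of_inner_le {z : Lp (EuclideanSpace ℝ (Fin d)) 2 (torusMeasure d)} {M : ℝ}
    (hM : 0 ≤ M) (h : ∀ F : Lp (EuclideanSpace ℝ (Fin d)) 2 (torusMeasure d),
      inner ℝ z F ≤ M * ∫ x, ‖F x‖ ∂(torusMeasure d)) :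
    ∀ᵐ x ∂(torusMeasure d), ‖z x‖ ≤ M := by
  have hz2 := Lp.memLp z
  have hA : MeasurableSet {x | M < ‖z x‖} :=
    measurableSet_lt measurable_const (Lp.stronglyMeasurable z).norm.measurable
  -- The test field is `z` cut off to the set where `|z| > M`.
  have hF := hz2.indicator hA
  have hae := hF.coeFn_toLp
  have h1 := h (hF.toLp _)
  rw [L2.inner_def, ← integral_const_mul] at h1
  have e1 : ∫ x, inner ℝ (z x) (hF.toLp _ x) ∂(torusMeasure d) =
      ∫ x, {x | M < ‖z x‖}.indicator (fun x => ‖z x‖ ^ 2) x ∂(torusMeasure d) := by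
    refine integral_congr_ae ?_
    filter_upwards [hae] with x hx
    rw [hx]
    by_cases hxA : x ∈ {x | M < ‖z x‖}
    · rw [Set.indicator_of_mem hxA, Set.indicator_of_mem hxA, real_inner_self_eq_norm_sq]
    · rw [Set.indicator_of_notMem hxA, Set.indicator_of_notMem hxA, inner_zero_right]
  have e2 : ∫ x, M * ‖hF.toLp _ x‖ ∂(torusMeasure d) =
      ∫ x, {x | M < ‖z x‖}.indicator (fun x => M * ‖z x‖) x ∂(torusMeasure d) := by
    refine integral_congr_ae ?_
    filter_upwards [hae] with x hx
    rw [hx]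
    by_cases hxA : x ∈ {x | M < ‖z x‖}
    · rw [Set.indicator_of_mem hxA, Set.indicator_of_mem hxA]
    · rw [Set.indicator_of_notMem hxA, Set.indicator_of_notMem hxA, norm_zero, mul_zero]
  have i1 : Integrable ({x | M < ‖z x‖}.indicator fun x => ‖z x‖ ^ 2) (torusMeasure d) :=
    ((memLp_two_iff_integrable_sq_norm hz2.1).1 hz2).indicator hA
  have i2 : Integrable ({x | M < ‖z x‖}.indicator fun x => M * ‖z x‖) (torusMeasure d) :=
    ((hz2.integrable (by norm_num)).norm.const_mul M).indicator hA
  have hnn : 0 ≤ᵐ[torusMeasure d] {x | M < ‖z x‖}.indicator (fun x => ‖z x‖ ^ 2) -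
      {x | M < ‖z x‖}.indicator fun x => M * ‖z x‖ := by
    refine Filter.Eventually.of_forall fun x => ?_
    by_cases hxA : x ∈ {x | M < ‖z x‖}
    · have : M < ‖z x‖ := hxA
      simp only [Pi.zero_apply, Pi.sub_apply, Set.indicator_of_mem hxA]
      nlinarith
    · simp [Set.indicator_of_notMem hxA]
  have hle : ∫ x, ({x | M < ‖z x‖}.indicator (fun x => ‖z x‖ ^ 2) -
      {x | M < ‖z x‖}.indicator fun x => M * ‖z x‖) x ∂(torusMeasure d) ≤ 0 := by
    rw [integral_sub' i1 i2, ← e1, ← e2]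
    linarith
  -- On the cut-off set `|z|² - M|z|` is strictly positive, yet its integral is at most zero; so the
  -- set is null.
  have hzero := (integral_eq_zero_iff_of_nonneg_ae hnn (i1.sub i2)).1
    (le_antisymm hle (integral_nonneg_of_ae hnn))
  filter_upwards [hzero] with x hx
  by_contra! hlt
  have hxA : x ∈ {x | M < ‖z x‖} := hlt
  simp only [Pi.zero_apply, Pi.sub_apply, Set.indicator_of_mem hxA] at hx
  nlinarith

theorem grad_add {f g : Torus d → ℝ} (hf : IsCn 1 f) (hg : IsCn 1 g) :
    grad (f + g) = grad f + grad g := by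
  funext x
  ext i
  exact partialDeriv_add hf hg i x

theorem grad_const_smul (c : ℝ) {f : Torus d → ℝ} (hf : IsCn 1 f) :
    grad (c • f) = c • grad f := by
  funext x
  ext i
  exact partialDeriv_const_smul c hf i x

/-- The smooth functions on the torus. -/
def smoothFunctions (d : ℕ) : Submodule ℝ (Torus d → ℝ) where
  carrier := {f | IsCn ⊤ f}
  zero_mem' := isCn_const 0
  add_mem' := IsCn.add
  smul_mem' c _ hf := hf.const_smul c

theorem isCn_one_coe (f : smoothFunctions d) : IsCn 1 (f : Torus d → ℝ) :=
  IsCn.of_le (show IsCn ⊤ (f : Torus d → ℝ) from f.2) le_top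

/-- The gradient of a smooth function, as a square integrable field. -/
def gradL2 (d : ℕ) :
    smoothFunctions d →ₗ[ℝ] Lp (EuclideanSpace ℝ (Fin d)) 2 (torusMeasure d) where
  toFun f := ((isCn_one_coe f).continuous_grad.memLp_torus 2).toLp
  map_add' f g := by
    rw [← MemLp.toLp_add]
    congr 1
    exact grad_add (isCn_one_coe f) (isCn_one_coe g)
  map_smul' c f := by
    rw [RingHom.id_apply, ← MemLp.toLp_const_smul]
    congr 1
    exact grad_const_smul c (isCn_one_coe f)

theorem coeFn_gradL2 (f : smoothFunctions d) :
    gradL2 d f =ᵐ[torusMeasure d] grad (f : Torus d → ℝ) :=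
  MemLp.coeFn_toLp ((isCn_one_coe f).continuous_grad.memLp_torus 2)

/-- Integration of smooth functions against a square integrable function. -/
def pairing (p : Lp ℝ 2 (torusMeasure d)) : smoothFunctions d →ₗ[ℝ] ℝ where
  toFun f := ∫ x, p x * (f : Torus d → ℝ) x ∂(torusMeasure d)
  map_add' f g := by
    rw [← integral_add ((integrable_L2 p).mul_continuous_torus (isCn_one_coe f).continuous)
      ((integrable_L2 p).mul_continuous_torus (isCn_one_coe g).continuous)]
    simp [mul_add]
  map_smul' c f := by
    rw [RingHom.id_apply, smul_eq_mul, ← integral_const_mul]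
    simp [mul_left_comm]

/-- The extension lives on `L²`, where Riesz yields a field, but the sublinear bound is `M` times
the `L¹` norm, which is what makes the field bounded. -/
theorem exists_field_of_le {p : Lp ℝ 2 (torusMeasure d)} {M : ℝ≥0}
    (h : ∀ ψ : Torus d → ℝ, IsCn ⊤ ψ →
      ∫ x, p x * ψ x ∂(torusMeasure d) ≤ M * ∫ x, ‖grad ψ x‖ ∂(torusMeasure d)) :
    ∃ z : BoundedField d, ‖z‖ ≤ M ∧ ∀ ψ : Torus d → ℝ, IsCn ⊤ ψ →
      ∫ x, inner ℝ (z x) (grad ψ x) ∂(torusMeasure d) = ∫ x, p x * ψ x ∂(torusMeasure d) := by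
  have hint : ∀ F : Lp (EuclideanSpace ℝ (Fin d)) 2 (torusMeasure d),
      Integrable F (torusMeasure d) := fun F => (Lp.memLp F).integrable (by norm_num)
  obtain ⟨f, hf, hfN⟩ := exists_extension_along (gradL2 d) (pairing p)
    (fun F => (M : ℝ) * ∫ x, ‖F x‖ ∂(torusMeasure d)) (fun c hc F => by
      change (M : ℝ) * ∫ x, ‖(c • F) x‖ ∂(torusMeasure d) =
        c * (M * ∫ x, ‖F x‖ ∂(torusMeasure d))
      rw [mul_left_comm, ← integral_const_mul c]
      congr 1
      refine integral_congr_ae ?_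
      filter_upwards [Lp.coeFn_smul c F] with x hx
      rw [hx, Pi.smul_apply, norm_smul, Real.norm_of_nonneg hc.le]) (fun F G => by
      rw [← mul_add, ← integral_add (hint F).norm (hint G).norm]
      refine mul_le_mul_of_nonneg_left ?_ M.2
      refine integral_mono_ae (hint _).norm ((hint F).norm.add (hint G).norm) ?_
      filter_upwards [Lp.coeFn_add F G] with x hx
      rw [hx]
      exact norm_add_le _ _) (fun ψ => by
      refine (h ψ ψ.2).trans (le_of_eq ?_)
      congr 1
      refine integral_congr_ae ?_
      filter_upwards [coeFn_gradL2 ψ] with x hx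
      rw [hx])
  -- The measure has mass one, so the `L¹` norm is at most the `L²` norm; this makes the extension
  -- continuous.
  have hL1 : ∀ F : Lp (EuclideanSpace ℝ (Fin d)) 2 (torusMeasure d),
      ∫ x, ‖F x‖ ∂(torusMeasure d) ≤ ‖F‖ := by
    intro F
    rw [integral_norm_eq_lintegral_enorm (hint F).1, ← eLpNorm_one_eq_lintegral_enorm, Lp.norm_def]
    exact ENNReal.toReal_mono (Lp.eLpNorm_ne_top F)
      (eLpNorm_le_eLpNorm_of_exponent_le (by norm_num) (hint F).1)
  have hle : ∀ F, f F ≤ M * ‖F‖ := fun F =>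
    (hfN F).trans (mul_le_mul_of_nonneg_left (hL1 F) M.2)
  let fc := f.mkContinuous (M : ℝ) fun F => abs_le.2 ⟨by
    have := hle (-F)
    rw [map_neg, norm_neg] at this
    linarith, hle F⟩
  let z := (InnerProductSpace.toDual ℝ _).symm fc
  have hz : ∀ F, inner ℝ z F = f F := fun F =>
    InnerProductSpace.toDual_symm_apply (x := F) (y := fc)
  have hbound := ae_norm_le_of_inner_le M.2 (z := z) fun F => (hz F).trans_le (hfN F)
  have hzm : MemLp z ∞ (torusMeasure d) := memLp_top_of_bound (Lp.memLp z).1 M hbound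
  refine ⟨hzm.toLp z, ?_, fun ψ hψ => ?_⟩
  · have hb : ∀ᵐ x ∂(torusMeasure d), ‖hzm.toLp z x‖ ≤ M := by
      filter_upwards [hbound, hzm.coeFn_toLp] with x h1 h2
      rw [h2]; exact h1
    simpa using Lp.norm_le_of_ae_bound M.2 hb
  · have h1 : inner ℝ z (gradL2 d ⟨ψ, hψ⟩) = ∫ x, p x * ψ x ∂(torusMeasure d) :=
      (hz _).trans (hf ⟨ψ, hψ⟩)
    rw [← h1, L2.inner_def]
    refine integral_congr_ae ?_
    filter_upwards [hzm.coeFn_toLp, coeFn_gradL2 ⟨ψ, hψ⟩] with x h2 h3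
    rw [h2, h3]

/-- If `(φ, v) ≤ M ∫ |∇φ|` for the smooth mean-zero functions `φ`, then `v` has a flux of norm at
most `M`. -/
theorem exists_isFluxOf {v : HNegAv d s} {M : ℝ≥0}
    (h : ∀ (φ : Torus d → ℝ) (a : Lp ℝ 2 (torusMeasure d)), IsCn ⊤ φ →
      ∫ x, φ x ∂(torusMeasure d) = 0 → a =ᵐ[torusMeasure d] φ →
      innerNeg (ofL2 a) v ≤ M * ∫ x, ‖grad φ x‖ ∂(torusMeasure d)) :
    ∃ z : BoundedField d, IsFluxOf z v ∧ ‖z‖ ≤ M := by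
  set p := (fracLaplacian d s).symm v with hp
  have hp0 : ∫ x, HsAv.toL2 p x ∂(torusMeasure d) = 0 := (HsAv.toL2_mem p).1
  obtain ⟨z, hzM, hz⟩ := exists_field_of_le (p := HsAv.toL2 p) (M := M) (by
    intro ψ hψ
    -- The hypothesis needs mean zero. Subtracting the mean changes neither the gradient nor the
    -- pairing with `p`, whose mean is zero.
    set c := ∫ x, ψ x ∂(torusMeasure d) with hc
    have hφ : IsCn ⊤ (ψ + fun _ => -c) := hψ.add (isCn_const _)
    have hφ0 : ∫ x, (ψ x + -c) ∂(torusMeasure d) = 0 := by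
      rw [integral_add hψ.continuous.integrable_torus (integrable_const _)]
      simp [hc]
    have ha := (hφ.continuous.memLp_torus 2).coeFn_toLp
    have key := h _ _ hφ hφ0 ha
    have hgrad : grad (ψ + fun _ => -c) = grad ψ := by
      rw [grad_add (hψ.of_le le_top) (isCn_const _)]
      funext x
      ext i
      simp [grad_apply, partialDeriv_const]
    rw [hgrad, innerNeg_ofL2, ← hp] at key
    refine le_trans (le_of_eq ?_) key
    have e : ∫ x, (hφ.continuous.memLp_torus 2).toLp _ x * HsAv.toL2 p x ∂(torusMeasure d) =
        ∫ x, (HsAv.toL2 p x * ψ x + HsAv.toL2 p x * -c) ∂(torusMeasure d) := by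
      refine integral_congr_ae ?_
      filter_upwards [ha] with x hx
      rw [hx, Pi.add_apply]
      ring
    rw [e, integral_add ((integrable_L2 _).mul_continuous_torus hψ.continuous)
      ((integrable_L2 _).mul_const _), integral_mul_const, hp0]
    simp)
  -- The field satisfies `∫ z·∇ψ = ∫ p ψ`, so its divergence is `-p`.
  refine ⟨z, ⟨-p, fun ψ hψ => ?_, by
    rw [fracLaplacian_neg, neg_neg, hp, LinearIsometryEquiv.apply_symm_apply]⟩, hzM⟩
  rw [hz ψ hψ, ← integral_neg]
  refine integral_congr_ae ?_
  rw [map_neg]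
  filter_upwards [Lp.coeFn_neg (HsAv.toL2 p)] with x hx
  rw [hx, Pi.neg_apply]
  ring

/-! ### The duality between `Φ` and `Ψ` -/

theorem innerNeg_comm (f g : HNegAv d s) : innerNeg f g = innerNeg g f := by
  obtain ⟨a, rfl⟩ := (fracLaplacian d s).surjective f
  obtain ⟨b, rfl⟩ := (fracLaplacian d s).surjective g
  rw [innerNeg, innerNeg, LinearIsometryEquiv.symm_apply_apply,
    LinearIsometryEquiv.symm_apply_apply, fracLaplacian, InnerProductSpace.toDual_apply_apply,
    InnerProductSpace.toDual_apply_apply, real_inner_comm]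

theorem innerNeg_sub_right (f g h : HNegAv d s) :
    innerNeg f (g - h) = innerNeg f g - innerNeg f h := rfl

theorem innerNeg_neg_left (f g : HNegAv d s) : innerNeg (-f) g = -innerNeg f g := by
  rw [innerNeg_comm, innerNeg_comm f]; rfl

/-- Vanishing total variation makes `f` orthogonal to every continuous function, in particular to
itself. -/
theorem Phi_eq_zero_innerNeg_ofL2 (hs : s ≤ 1) {f : Torus d → ℝ} (hf : Continuous f)
    (h0 : ∫ x, f x ∂(torusMeasure d) = 0) {a : Lp ℝ 2 (torusMeasure d)}
    (ha : a =ᵐ[torusMeasure d] f) (hPhi : Phi (ofL2 a : HNegAv d s) = 0) (v : HNegAv d s) :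
    innerNeg (ofL2 a) v = 0 := by
  rw [Phi_eq_totalVariation hs (isFunction_ofL2 ha h0)] at hPhi
  have h := integral_mul_eq_zero_of_totalVariation hf.integrable_torus h0 hPhi hf
  have hae := (integral_eq_zero_iff_of_nonneg (fun x => mul_self_nonneg (f x))
    (hf.mul hf).integrable_torus).1 h
  rw [innerNeg_ofL2]
  refine integral_eq_zero_of_ae ?_
  filter_upwards [hae, ha] with x h1 h2
  have h3 : f x = 0 := mul_self_eq_zero.1 h1
  rw [h2, h3, zero_mul, Pi.zero_apply]

/-- A bound of the functional `(·, v)` by a multiple of `Φ` gives a flux of `v`. -/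
theorem exists_isFluxOf_of_le_Phi (hs : s ≤ 1) {v : HNegAv d s} {M : ℝ≥0}
    (h : ∀ w : HNegAv d s, Phi w ≠ ∞ → Phi w ≠ 0 → innerNeg w v ≤ M * (Phi w).toReal) :
    ∃ z : BoundedField d, IsFluxOf z v ∧ ‖z‖ ≤ M := by
  refine exists_isFluxOf fun φ a hφ h0 ha => ?_
  have hI : 0 ≤ ∫ x, ‖grad φ x‖ ∂(torusMeasure d) := integral_nonneg fun _ => norm_nonneg _
  -- The hypothesis leaves out `Φ = 0`, because a quotient by zero is `0` in `EReal` and carries no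
  -- bound; here the pairing itself vanishes.
  by_cases hPhi : Phi (ofL2 a : HNegAv d s) = 0
  · rw [Phi_eq_zero_innerNeg_ofL2 hs hφ.continuous h0 ha hPhi]
    positivity
  · have hle : Phi (ofL2 a : HNegAv d s) ≤
        ENNReal.ofReal (∫ x, ‖grad φ x‖ ∂(torusMeasure d)) := by
      rw [Phi_eq_totalVariation hs (isFunction_ofL2 ha h0)]
      exact totalVariation_le (hφ.of_le le_top)
    refine (h _ (ne_top_of_le_ne_top ENNReal.ofReal_ne_top hle) hPhi).trans ?_
    exact mul_le_mul_of_nonneg_left (ENNReal.toReal_le_of_le_ofReal hI hle) M.2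

theorem dualFunctional_Phi_le_Psi (hs : s ≤ 1) (v : HNegAv d s) :
    dualFunctional Phi v ≤ ((Psi v : ℝ≥0∞) : EReal) := by
  refine iSup₂_le fun w _ => ?_
  -- In `EReal` a real number divided by `⊤` or by `0` is `0`, so these two cases only need `Psi v ≥
  -- 0`.
  by_cases htop : Phi w = ∞
  · simp [htop, EReal.coe_ennreal_nonneg]
  by_cases hzero : Phi w = 0
  · simp [hzero, EReal.coe_ennreal_nonneg]
  have hpos : 0 < (Phi w).toReal := ENNReal.toReal_pos hzero htop
  have hcoe : ((Phi w : ℝ≥0∞) : EReal) = (((Phi w).toReal : ℝ) : EReal) :=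
    (EReal.coe_ennreal_toReal htop).symm
  rw [hcoe, ← EReal.coe_div]
  have hle : ENNReal.ofReal (innerNeg w v / (Phi w).toReal) ≤ Psi v := by
    refine le_iInf₂ fun z hz => ?_
    rw [ENNReal.ofReal_div_of_pos hpos, ENNReal.ofReal_toReal htop]
    exact ENNReal.div_le_of_le_mul (ofReal_innerNeg_le_Phi hs w hz htop)
  refine le_trans ?_ (EReal.coe_ennreal_le_coe_ennreal_iff.2 hle)
  rw [EReal.coe_ennreal_ofReal]
  exact_mod_cast le_max_left _ _

/-- Without a nonzero element the supremum in `dualFunctional` would be empty, hence `⊥`. A cosine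
paired with itself serves, and its nonzero frequency requires `d ≥ 1`. -/
theorem exists_ne_zero_hNegAv (hd : 1 ≤ d) (hs : s ≤ 1) : ∃ w : HNegAv d s, w ≠ 0 := by
  let ξ : Fin d → ℤ := Pi.single ⟨0, hd⟩ 1
  have hξ : ξ ≠ 0 := by simp [ξ]
  have hc := (isCn_trigCos ξ).continuous
  obtain ⟨φ, hφ⟩ := exists_hsAv hs ((isCn_trigCos ξ).of_le le_top) (integral_trigCos hξ)
  refine ⟨ofL2 (HsAv.toL2 φ), fun h => ?_⟩
  have h1 := ofL2_apply_of_ae hφ φ hφ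
  rw [h] at h1
  have h2 : 0 < ∫ x, trigCos ξ x * trigCos ξ x ∂(torusMeasure d) := by
    refine (hc.mul hc).integral_pos_of_hasCompactSupport_nonneg_nonzero
      (HasCompactSupport.of_compactSpace _) (fun x => mul_self_nonneg _) (x := 0) ?_
    rw [← proj_zero, trigCos_proj]
    simp
  exact h2.ne h1

/-- One of `w` and `-w` has a nonnegative product with `v`. -/
theorem dualFunctional_nonneg (hd : 1 ≤ d) (hs : s ≤ 1) (F : HNegAv d s → ℝ≥0∞)
    (v : HNegAv d s) : 0 ≤ dualFunctional F v := by
  have key : ∀ w : HNegAv d s, w ≠ 0 → 0 ≤ innerNeg w v → 0 ≤ dualFunctional F v := by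
    intro w hw h
    exact le_iSup₂_of_le w hw
      (EReal.div_nonneg (by exact_mod_cast h) (EReal.coe_ennreal_nonneg _))
  obtain ⟨w, hw⟩ := exists_ne_zero_hNegAv (s := s) hd hs
  rcases le_total 0 (innerNeg w v) with h | h
  · exact key w hw h
  · exact key (-w) (neg_ne_zero.2 hw) (by rw [innerNeg_neg_left]; linarith)

theorem Psi_le_dualFunctional_Phi (hd : 1 ≤ d) (hs : s ≤ 1) (v : HNegAv d s) :
    ((Psi v : ℝ≥0∞) : EReal) ≤ dualFunctional Phi v := by
  have hnn := dualFunctional_nonneg hd hs Phi v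
  by_cases htop : dualFunctional Phi v = ⊤
  · rw [htop]; exact le_top
  have hbot : dualFunctional Phi v ≠ ⊥ := (lt_of_lt_of_le EReal.bot_lt_zero hnn).ne'
  -- Neither `⊤` nor `⊥`, the supremum is a real number `M ≥ 0`, which serves as the constant of the
  -- flux construction.
  have hM : dualFunctional Phi v = (((dualFunctional Phi v).toReal.toNNReal : ℝ≥0) : ℝ) := by
    rw [Real.coe_toNNReal _ (EReal.toReal_nonneg hnn), EReal.coe_toReal htop hbot]
  set M := (dualFunctional Phi v).toReal.toNNReal
  obtain ⟨z, hz, hzM⟩ := exists_isFluxOf_of_le_Phi hs (v := v) (M := M) (by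
    intro w hw1 hw0
    have hpos : 0 < (Phi w).toReal := ENNReal.toReal_pos hw0 hw1
    by_cases hw : w = 0
    · subst hw
      rw [innerNeg_comm]
      exact mul_nonneg M.2 hpos.le
    have hle : ((innerNeg w v : ℝ) : EReal) / ((Phi w : ℝ≥0∞) : EReal) ≤ ((M : ℝ) : EReal) := by
      rw [← hM]
      exact le_iSup₂_of_le w hw le_rfl
    rw [← EReal.coe_ennreal_toReal hw1, ← EReal.coe_div] at hle
    exact (div_le_iff₀ hpos).1 (by exact_mod_cast hle))
  rw [hM]
  have h1 : Psi v ≤ (M : ℝ≥0∞) := (iInf₂_le z hz).trans (by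
    rw [← enorm_norm, Real.enorm_of_nonneg (norm_nonneg z)]
    exact ENNReal.ofReal_le_of_le_toReal hzM)
  exact EReal.coe_ennreal_le_coe_ennreal_iff.2 h1

/-! ### The subdifferential of `Φ` -/

theorem Phi_zero (hs : s ≤ 1) : Phi (0 : HNegAv d s) = 0 := by
  have h : IsFunction (0 : HNegAv d s) (fun _ => 0) :=
    ⟨integrable_const _, by simp, fun _ _ _ _ => by simp⟩
  rw [Phi_eq_totalVariation hs h]
  simp [totalVariation]

/-- The only part of the homogeneity of `Φ` that the subdifferential needs. -/
theorem Phi_add_self_le (hs : s ≤ 1) {u : HNegAv d s} {g : Torus d → ℝ} (hg : IsFunction u g) :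
    Phi (u + u) ≤ 2 * totalVariation g := by
  have h : IsFunction (u + u) fun x => 2 * g x := by
    refine ⟨hg.1.const_mul 2, by rw [integral_const_mul, hg.2.1, mul_zero], fun φ ψ hψ hφ => ?_⟩
    simp_rw [mul_assoc]
    rw [integral_const_mul, ← hg.2.2 φ ψ hψ hφ, two_mul]
    rfl
  rw [Phi_eq_totalVariation hs h]
  refine iSup_le fun z => iSup₂_le fun hz h1 => ?_
  simp_rw [mul_assoc]
  rw [integral_const_mul, ENNReal.ofReal_mul two_pos.le, ENNReal.ofReal_ofNat]
  gcongr
  exact le_iSup₂_of_le z hz (le_iSup_of_le h1 le_rfl)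

theorem mem_subdifferential_Phi_iff (hs : s ≤ 1) {u : HNegAv d s} {g : Torus d → ℝ}
    (hg : IsFunction u g) (hfin : totalVariation g < ∞) (v : HNegAv d s) :
    v ∈ subdifferential Phi u ↔ ∃ z : BoundedField d, IsFluxOf z v ∧ ‖z‖ ≤ 1 ∧
      ((innerNeg u v : ℝ) : EReal) = ((totalVariation g : ℝ≥0∞) : EReal) := by
  have hPu := Phi_eq_totalVariation hs hg
  have hPufin : Phi u ≠ ∞ := by rw [hPu]; exact hfin.ne
  -- Competitors with `Φ(w) = ∞` impose nothing, so the condition becomes an inequality between real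
  -- numbers.
  have hmem : v ∈ subdifferential Phi u ↔ ∀ w : HNegAv d s, Phi w ≠ ∞ →
      (Phi u).toReal + (innerNeg w v - innerNeg u v) ≤ (Phi w).toReal := by
    refine forall_congr' fun w => ?_
    by_cases hw : Phi w = ∞
    · simp [hw]
    · rw [← EReal.coe_ennreal_toReal hPufin, ← EReal.coe_ennreal_toReal hw,
        innerNeg_sub_right, innerNeg_comm v w, innerNeg_comm v u]
      simp only [ne_eq, hw, not_false_eq_true, true_imp_iff]
      norm_cast
  have heq : ((innerNeg u v : ℝ) : EReal) = ((totalVariation g : ℝ≥0∞) : EReal) ↔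
      innerNeg u v = (Phi u).toReal := by
    rw [← hPu, ← EReal.coe_ennreal_toReal hPufin]
    norm_cast
  rw [hmem, heq]
  constructor
  · intro h
    -- The competitor `0` gives `Φ(u) ≤ (u, v)`; the competitor `2u` gives the reverse inequality.
    have h0 := h 0 (by simp [Phi_zero hs])
    have h2 : (Phi u).toReal + (innerNeg (u + u) v - innerNeg u v) ≤ 2 * (Phi u).toReal := by
      have hle := Phi_add_self_le hs hg
      rw [← hPu] at hle
      have hne : 2 * Phi u ≠ ∞ := ENNReal.mul_ne_top (by norm_num) hPufin
      refine (h (u + u) (ne_top_of_le_ne_top hne hle)).trans ?_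
      simpa using ENNReal.toReal_mono hne hle
    have e0 : innerNeg 0 v = 0 := by rw [innerNeg_comm]; rfl
    have e2 : innerNeg (u + u) v = innerNeg u v + innerNeg u v := by
      rw [innerNeg_comm, innerNeg_comm u]; rfl
    rw [Phi_zero hs, e0, ENNReal.toReal_zero] at h0
    rw [e2] at h2
    have hu : innerNeg u v = (Phi u).toReal := by linarith
    -- Once `(u, v) = Φ(u)`, these terms cancel in the subgradient inequality and leave `(w, v) ≤
    -- Φ(w)`.
    obtain ⟨z, hz, hz1⟩ := exists_isFluxOf_of_le_Phi hs (v := v) (M := 1) fun w hw _ => by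
      have := h w hw
      rw [NNReal.coe_one, one_mul]
      linarith
    exact ⟨z, hz, by simpa using hz1, hu⟩
  · rintro ⟨z, hz, hz1, hu⟩ w hw
    have h1 : ENNReal.ofReal (innerNeg w v) ≤ Phi w := by
      refine (ofReal_innerNeg_le_Phi hs w hz hw).trans (mul_le_of_le_one_left' ?_)
      rw [← enorm_norm, Real.enorm_of_nonneg (norm_nonneg z)]
      rw [ENNReal.ofReal_le_one]
      exact hz1
    have h2 := (ENNReal.ofReal_le_iff_le_toReal hw).1 h1
    linarith

end TorusTV

end

theorem theorem1 (d : ℕ) (hd : 1 ≤ d) (s : ℝ≥0) (hs : s ≤ 1) :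
    (∀ w : TorusTV.HNegAv d s,
      TorusTV.dualFunctional TorusTV.Phi w = ((TorusTV.Psi w : ℝ≥0∞) : EReal)) ∧
    (∀ (u : TorusTV.HNegAv d s) (g : TorusTV.Torus d → ℝ), TorusTV.IsFunction u g →
      TorusTV.totalVariation g < ∞ →
      ∀ v : TorusTV.HNegAv d s, v ∈ TorusTV.subdifferential TorusTV.Phi u ↔
        ∃ z : TorusTV.BoundedField d, TorusTV.IsFluxOf z v ∧ ‖z‖ ≤ 1 ∧
          ((TorusTV.innerNeg u v : ℝ) : EReal) =
            ((TorusTV.totalVariation g : ℝ≥0∞) : EReal)) :=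
  ⟨fun w => le_antisymm (TorusTV.dualFunctional_Phi_le_Psi hs w)
    (TorusTV.Psi_le_dualFunctional_Phi hd hs w),
    fun _ _ hg hfin v => TorusTV.mem_subdifferential_Phi_iff hs hg hfin v⟩
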